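/- NUMBER PARTITIONING is the following decision problem: given positive integers $t$ and $a_1,\dots,a_m$ ($m\ge 1$) such that $\sum_{i=1}^m a_i$ is divisible by $t$, decide whether there is a partition of $\{1,\dots,m\}$ into $t$ sets $I_1,\dots,I_t$ with $\sum_{i\in I_j}a_i=\frac1t\sum_{i=1}^m a_i$ for all $j=1,\dots,t$. For $p\in[0,1]^n$ let $\mu_p$ be the probability measure on $\{0,1\}^n\subseteq[0,1]^n$ with $\mu_p(\{x\})=\prod_{i:x_i=1}p_i\prod_{i:x_i=0}(1-p_i)$. A finite set $B\subseteq[0,1]^n$ is a Pareto cover of $\mu_p$ if $\mu_p(\{x : x\le b\text{ for some }b\in B\})=1$ (where $x\le b$ is meant coordinatewise). For $c\in\mathbb{Q}^n_{\ge0}$ put $c_B(x)=\min\{c^{\mathsf T}b : b\in B,\ x\le b\}$ (with $\min\emptyset=\infty$). The binary Pareto cover decision problem is: given $p\in([0,1]\cap\mathbb{Q})^n$, $c\in\mathbb{Q}^n_{\ge 0}$, $\gamma\in\mathbb{Q}$ and an integer $k\ge1$, decide whether there is a Pareto cover $B\subseteq[0,1]^n$ of $\mu_p$ with $|B|=k$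 and $\operatorname{E}_{\mu_p}[c_B]\le\gamma$. In both problems all numbers are encoded in binary, a rational number being given by a numerator and a positive denominator (not necessarily in lowest terms). Theorem. There is a polynomial-time (many-one) reduction from NUMBER PARTITIONING to the binary Pareto cover decision problem, i.e., a map computable by a Turing machine in time polynomial in the encoding length of the input that maps "yes" instances to "yes" instances and "no" instances to "no" instances, with the following property. It maps every instance $t,a_1,\dots,a_m$ to an instance with $n=m+1$ coordinates and cover size $k=t+2$, namely, with $S=\sum_{i=1}^m a_i$ and $M=13\,S^2$, to the one given by \[ p_i=\frac{a_i}{M^4},\quad c_i=a_i\quad(i=1,\dots,m),\qquad p_{m+1}=\frac1{M^6},\quad c_{m+1}=2M,\qquad \gamma=\frac1{M^4}\cdot\frac{S^2}{t}+\frac6{M^5}. \] -/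

import Mathlib

open MeasureTheory Computability
open scoped ENNReal

namespace ParetoCover

/-! ### Decision problems and polynomial-time many-one reductions -/

/-- A decision problem: its instances, an encoding of the instances by words over the finite
alphabet `Γ'` (which contains the two bits and a comma), and the set of "yes" instances. -/
structure DecisionProblem where
  Instance : Type
  encode : Instance → List Γ'
  encode_injective : Function.Injective encode
  IsYes : Instance → Prop

/-- `f` is a polynomial-time (many-one) reduction from `A` to `B`: a Turing machine computes `f` on
the encoded instances in a number of steps that is polynomial in the length of the encoded input,
and `f` maps "yes" instances to "yes" instances and "no" instances to "no" instances. -/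
def IsPolyTimeReduction (A B : DecisionProblem) (f : A.Instance → B.Instance) : Prop :=
  Nonempty (Turing.TM2ComputableInPolyTime A.encode B.encode f) ∧
    ∀ I : A.Instance, A.IsYes I ↔ B.IsYes (f I)

/-! ### Binary encodings -/

/-- The encoding of a finite list of natural numbers: every number is written in binary and is
followed by a comma. -/
def encodeNats (l : List ℕ) : List Γ' :=
  l.flatMap fun a => (encodeNat a).map Γ'.bit ++ [Γ'.comma]

theorem bits_append_comma_inj {u v : List Bool} {x y : List Γ'}
    (h : u.map Γ'.bit ++ Γ'.comma :: x = v.map Γ'.bit ++ Γ'.comma :: y) : u = v ∧ x = y := by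
  induction u generalizing v with
  | nil =>
    cases v with
    | nil => simpa using h
    | cons b v => simp at h
  | cons a u ih =>
    cases v with
    | nil => simp at h
    | cons b v =>
      simp only [List.map_cons, List.cons_append, List.cons.injEq, Γ'.bit.injEq] at h
      obtain ⟨h1, h2⟩ := ih h.2
      exact ⟨by rw [h.1, h1], h2⟩

theorem encodeNats_injective : Function.Injective encodeNats := by
  intro l
  induction l with
  | nil =>
    intro l' h
    cases l' with
    | nil => rfl
    | cons b l' => simp [encodeNats] at h
  | cons a l ih =>
    intro l' h
    cases l' with
    | nil => simp [encodeNats] at h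
    | cons b l' =>
      simp only [encodeNats, List.flatMap_cons, List.append_assoc, List.singleton_append] at h
      obtain ⟨h1, h2⟩ := bits_append_comma_inj h
      have h3 : a = b := by
        have := congrArg decodeNat h1
        simpa using this
      rw [h3, ih h2]

/-- A rational number given as a quotient of an integer and a positive integer
(not necessarily in lowest terms). -/
@[ext]
structure Fraction where
  num : ℤ
  den : ℕ
  den_pos : 0 < den

namespace Fraction

/-- The rational number that a fraction represents. -/
def val (q : Fraction) : ℚ := (q.num : ℚ) / (q.den : ℚ)

/-- Sign, absolute value of the numerator, and denominator. -/
def toNats (q : Fraction) : List ℕ := [if q.num < 0 then 1 else 0, q.num.natAbs, q.den]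

theorem toNats_append_inj {q r : Fraction} {x y : List ℕ}
    (h : q.toNats ++ x = r.toNats ++ y) : q = r ∧ x = y := by
  simp only [toNats, List.cons_append, List.nil_append, List.cons.injEq] at h
  obtain ⟨h1, h2, h3, h4⟩ := h
  refine ⟨Fraction.ext ?_ h3, h4⟩
  split_ifs at h1 <;> omega

end Fraction

/-! ### NUMBER PARTITIONING -/

/-- An instance of NUMBER PARTITIONING: positive integers `t` and `a₁, …, aₘ` such that
`a₁ + ⋯ + aₘ` is divisible by `t`. -/
@[ext]
structure NumberPartitioningInstance where
  m : ℕ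
  t : ℕ
  a : Fin m → ℕ
  m_pos : 0 < m
  t_pos : 0 < t
  a_pos : ∀ i, 0 < a i
  dvd_sum : t ∣ ∑ i, a i

namespace NumberPartitioningInstance

/-- The encoding `t, a₁, …, aₘ` (all numbers in binary). -/
def encode (I : NumberPartitioningInstance) : List Γ' :=
  encodeNats (I.t :: List.ofFn I.a)

theorem encode_injective : Function.Injective encode := by
  rintro ⟨m, t, a, _, _, _, _⟩ ⟨m', t', a', _, _, _, _⟩ h
  have h' := encodeNats_injective h
  simp only [List.cons.injEq] at h'
  obtain ⟨rfl, h2⟩ := h'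
  have hm : m = m' := by simpa using congrArg List.length h2
  subst hm
  obtain rfl := List.ofFn_injective h2
  rfl

/-- There is a partition of the index set into `t` sets `P 1, …, P t`, each of which has the sum
`(1 / t) * (a₁ + ⋯ + aₘ)`. -/
def IsYes (I : NumberPartitioningInstance) : Prop :=
  ∃ P : Fin I.t → Finset (Fin I.m),
    Pairwise (fun j l => Disjoint (P j) (P l)) ∧
    (∀ i, ∃ j, i ∈ P j) ∧
    ∀ j, ∑ i ∈ P j, (I.a i : ℚ) = 1 / (I.t : ℚ) * ∑ i, (I.a i : ℚ)

end NumberPartitioningInstance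

/-- The decision problem NUMBER PARTITIONING. -/
def numberPartitioning : DecisionProblem where
  Instance := NumberPartitioningInstance
  encode := NumberPartitioningInstance.encode
  encode_injective := NumberPartitioningInstance.encode_injective
  IsYes := NumberPartitioningInstance.IsYes

/-! ### Pareto covers -/

/-- The cube `[0,1]ⁿ`, with the coordinatewise order and the Borel σ-algebra. -/
abbrev Cube (n : ℕ) : Type := Fin n → unitInterval

/-- The point of `{0,1}ⁿ ⊆ [0,1]ⁿ` with the given coordinates. -/
def binaryPoint {n : ℕ} (x : Fin n → Bool) : Cube n := fun i => if x i then 1 else 0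

/-- The measure `μ_p`, which is carried by `{0,1}ⁿ` and gives a point `x ∈ {0,1}ⁿ` the mass
`∏_{i : xᵢ = 1} pᵢ * ∏_{i : xᵢ = 0} (1 - pᵢ)`. -/
noncomputable def bernoulliMeasure {n : ℕ} (p : Fin n → ℝ) : Measure (Cube n) :=
  ∑ x : Fin n → Bool,
    ENNReal.ofReal ((∏ i with x i = true, p i) * ∏ i with x i = false, (1 - p i)) •
      Measure.dirac (binaryPoint x)

/-- `B` is a Pareto cover of `μ`: almost every point is covered by a point of `B`. -/
def IsParetoCover {n : ℕ} (μ : Measure (Cube n)) (B : Finset (Cube n)) : Prop :=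
  μ {x | ∃ b ∈ B, x ≤ b} = 1

/-- `c_B x`, the smallest cost `cᵀ b` of a point `b ∈ B` that covers `x` (`∞` if there is none),
for a cost vector `c` with nonnegative entries. -/
noncomputable def coverCost {n : ℕ} (c : Fin n → ℝ) (B : Finset (Cube n)) (x : Cube n) : ℝ≥0∞ :=
  ⨅ b ∈ B, ⨅ _ : x ≤ b, ENNReal.ofReal (∑ i, c i * (b i : ℝ))

/-- The expected cost `E_μ[c_B]`, for a cost vector `c` with nonnegative entries. -/
noncomputable def expectedCost {n : ℕ} (μ : Measure (Cube n)) (c : Fin n → ℝ)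
    (B : Finset (Cube n)) : ℝ≥0∞ :=
  ∫⁻ x, coverCost c B x ∂μ

/-! ### The binary Pareto cover problem -/

/-- An instance of the binary Pareto cover problem: `p ∈ ([0,1] ∩ ℚ)ⁿ`, `c ∈ ℚⁿ` with nonnegative
entries, `γ ∈ ℚ` and an integer `k ≥ 1`. -/
@[ext]
structure BinaryParetoInstance where
  n : ℕ
  k : ℕ
  γ : Fraction
  p : Fin n → Fraction
  c : Fin n → Fraction
  k_pos : 0 < k
  p_mem : ∀ i, (p i).val ∈ Set.Icc (0 : ℚ) 1
  c_nonneg : ∀ i, 0 ≤ (c i).val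

namespace BinaryParetoInstance

/-- The encoding `k, γ, p₁, c₁, …, pₙ, cₙ` (all integers in binary). -/
def encode (J : BinaryParetoInstance) : List Γ' :=
  encodeNats (J.k :: (J.γ.toNats ++
    (List.ofFn fun i => (J.p i).toNats ++ (J.c i).toNats).flatten))

theorem flatten_inj {l l' : List (Fraction × Fraction)}
    (h : (l.map fun q => q.1.toNats ++ q.2.toNats).flatten =
      (l'.map fun q => q.1.toNats ++ q.2.toNats).flatten) : l = l' := by
  induction l generalizing l' with
  | nil =>
    cases l' with
    | nil => rfl
    | cons r l' => simp [Fraction.toNats] at h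
  | cons q l ih =>
    cases l' with
    | nil => simp [Fraction.toNats] at h
    | cons r l' =>
      simp only [List.map_cons, List.flatten_cons, List.append_assoc] at h
      obtain ⟨h1, h⟩ := Fraction.toNats_append_inj h
      obtain ⟨h2, h⟩ := Fraction.toNats_append_inj h
      rw [Prod.ext h1 h2, ih h]

theorem encode_injective : Function.Injective encode := by
  rintro ⟨n, k, γ, p, c, _, _, _⟩ ⟨n', k', γ', p', c', _, _, _⟩ h
  have h' := encodeNats_injective h
  simp only [List.cons.injEq] at h'
  obtain ⟨rfl, h2⟩ := h'
  obtain ⟨rfl, h3⟩ := Fraction.toNats_append_inj h2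
  have h4 : (List.ofFn fun i => (p i, c i)) = List.ofFn fun i => (p' i, c' i) := by
    apply flatten_inj
    simpa [List.map_ofFn, Function.comp_def] using h3
  have hn : n = n' := by simpa using congrArg List.length h4
  subst hn
  have h5 := List.ofFn_injective h4
  obtain rfl : p = p' := funext fun i => congrArg Prod.fst (congrFun h5 i)
  obtain rfl : c = c' := funext fun i => congrArg Prod.snd (congrFun h5 i)
  rfl

/-- There is a Pareto cover `B ⊆ [0,1]ⁿ` of `μ_p` such that `|B| = k` and `E[c_B] ≤ γ`. -/
def IsYes (J : BinaryParetoInstance) : Prop :=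
  ∃ B : Finset (Cube J.n),
    IsParetoCover (bernoulliMeasure fun i => ((J.p i).val : ℝ)) B ∧
    B.card = J.k ∧
    ((expectedCost (bernoulliMeasure fun i => ((J.p i).val : ℝ))
      (fun i => ((J.c i).val : ℝ)) B : ℝ≥0∞) : EReal) ≤ (((J.γ.val : ℚ) : ℝ) : EReal)

end BinaryParetoInstance

/-- The decision variant of the binary Pareto cover problem. -/
def binaryParetoCover : DecisionProblem where
  Instance := BinaryParetoInstance
  encode := BinaryParetoInstance.encode
  encode_injective := BinaryParetoInstance.encode_injective
  IsYes := BinaryParetoInstance.IsYes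

end ParetoCover

/-
The entries of the target instance are polynomials of fixed shape in `t`, `S` and the `aᵢ`. Hence a
machine computes them by a fixed list of additions and multiplications of binary numbers, between
one pass over the input that sums the `aᵢ` and a second one that writes the output. Structured
programs are compiled to stack machines so that running times add up along the program.

All probabilities are so small that, up to terms of order `M⁻⁵`, only the unit vectors contribute to
the expected cost. A solution `I₁, …, I_t` of the partition problem yields the cover that consists
of `0`, of the all-ones vector, and of the incidence vectors of the `I_j`, each of cost `S / t`.

Conversely, `μ_p` gives positive mass to every point, so a cover must contain the all-ones vector.
If its expected cost is at most `γ`, then it also contains a point with no coordinate equal to `1`,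
because the zero vector has to be cheap, and the cheapest point that covers the `i`-th unit vector,
`i ≤ m`, costs less than `2 M` and so is not the all-ones vector. These cheapest points are thus
among the other `t` points of the cover and partition `{1, …, m}` into `t` blocks, and the cost at
the `i`-th unit vector is at least the sum of the block of `i`. If `sⱼ` are the block sums, then the
expected cost is at least about `M⁻⁴ ∑ⱼ sⱼ²`, so that `γ` forces the integer `∑ⱼ sⱼ²` to be less
than `S² / t + 1`. By the integrality of `S / t` it is at most `S² / t`, so all `sⱼ` are equal.
-/

/-! ### Structured programs for stack machines -/

namespace StackProgram

/-- Structured programs for a machine with stacks `K` over the alphabet `A`. `pop k P` removes the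
top symbol of the stack `k` and continues with the program that `P` assigns to it (`none` if `k` is
empty); `loop k P` pops `k` until it is empty and runs `P x` for every symbol `x` found. -/
inductive Prog (K A : Type)
  | skip
  | push (k : K) (x : A)
  | pop (k : K) (P : Option A → Prog K A)
  | seq (P Q : Prog K A)
  | loop (k : K) (P : A → Prog K A)

variable {K A : Type}

namespace Prog

/-- The labels of the compiled program. -/
def Label : Prog K A → Type
  | skip => Unit
  | push _ _ => Unit
  | pop _ P => Option (Σ x, (P x).Label)
  | seq P Q => P.Label ⊕ Q.Label
  | loop _ P => Option (Σ x, (P x).Label)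

instance instFintypeLabel [Fintype A] : (P : Prog K A) → Fintype P.Label
  | skip => inferInstanceAs (Fintype Unit)
  | push _ _ => inferInstanceAs (Fintype Unit)
  | pop _ P =>
    have := fun x => instFintypeLabel (P x)
    inferInstanceAs (Fintype (Option (Σ x, (P x).Label)))
  | seq P Q =>
    have := instFintypeLabel P
    have := instFintypeLabel Q
    inferInstanceAs (Fintype (P.Label ⊕ Q.Label))
  | loop _ P =>
    have := fun x => instFintypeLabel (P x)
    inferInstanceAs (Fintype (Option (Σ x, (P x).Label)))

/-- The label at which the compiled program starts. -/
def entry : (P : Prog K A) → P.Label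
  | skip => ()
  | push _ _ => ()
  | pop _ _ => none
  | seq P _ => .inl P.entry
  | loop _ _ => none

/-- The compiled program inside a machine with labels `Λ`, where `e` embeds the labels of the
program and the machine continues at `next`. The internal state holds the symbol popped last. -/
def code {Λ : Type} : (P : Prog K A) → (P.Label → Λ) → Λ → P.Label →
    Turing.TM2.Stmt (fun _ : K => A) Λ (Option A)
  | skip, _, next, _ => .goto fun _ => next
  | push k x, _, next, _ => .push k (fun _ => x) (.goto fun _ => next)
  | pop k P, e, _, none => .pop k (fun _ x => x) (.goto fun x => e (some ⟨x, (P x).entry⟩))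
  | pop _ P, e, next, some ⟨x, l⟩ => (P x).code (fun l => e (some ⟨x, l⟩)) next l
  | seq P Q, e, _, .inl l => P.code (fun l => e (.inl l)) (e (.inr Q.entry)) l
  | seq _ Q, e, next, .inr l => Q.code (fun l => e (.inr l)) next l
  | loop k P, e, next, none =>
    .pop k (fun _ x => x) (.goto fun x => x.elim next fun x => e (some ⟨x, (P x).entry⟩))
  | loop _ P, e, _, some ⟨x, l⟩ => (P x).code (fun l => e (some ⟨x, l⟩)) (e none) l

end Prog

variable [DecidableEq K]

/-- The machine `M` gets from `c` to `d` in at most `n` steps. -/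
def Reaches {Λ σ : Type} (M : Λ → Turing.TM2.Stmt (fun _ : K => A) Λ σ)
    (c d : Turing.TM2.Cfg (fun _ : K => A) Λ σ) (n : ℕ) : Prop :=
  Nonempty (StateTransition.EvalsToInTime (Turing.TM2.step M) c (some d) n)

section Reaches

variable {Λ σ : Type} {M : Λ → Turing.TM2.Stmt (fun _ : K => A) Λ σ}
  {c d e : Turing.TM2.Cfg (fun _ : K => A) Λ σ} {m n : ℕ}

theorem Reaches.trans (h : Reaches M c d m) (h' : Reaches M d e n) : Reaches M c e (n + m) :=
  h.elim fun h => h'.elim fun h' => ⟨.trans _ _ _ _ _ _ h h'⟩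

theorem Reaches.step (h : Turing.TM2.step M c = some d) : Reaches M c d 1 :=
  ⟨⟨⟨1, h⟩, le_rfl⟩⟩

theorem Reaches.mono (h : Reaches M c d m) (hmn : m ≤ n) : Reaches M c d n :=
  h.elim fun h => ⟨⟨h.toEvalsTo, h.steps_le_m.trans hmn⟩⟩

end Reaches

/-- In every machine that contains the compiled program `P`, and whatever the internal state is, the
program transforms the stacks `S` into `S'` in at most `n` steps. -/
def Does (P : Prog K A) (S S' : K → List A) (n : ℕ) : Prop :=
  ∀ (Λ : Type) (M : Λ → Turing.TM2.Stmt (fun _ : K => A) Λ (Option A)) (e : P.Label → Λ) (next : Λ),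
    (∀ l, M (e l) = P.code e next l) →
      ∀ v, ∃ v', Reaches M ⟨some (e P.entry), v, S⟩ ⟨some next, v', S'⟩ n

namespace Does

variable {P Q : Prog K A} {S S' S'' : K → List A} {m n : ℕ} {k : K}

theorem mono (h : Does P S S' m) (hmn : m ≤ n) : Does P S S' n := fun Λ M e next he v =>
  (h Λ M e next he v).imp fun _ h => h.mono hmn

theorem congr (h : Does P S S' m) (hS : S' = S'') (hmn : m ≤ n) : Does P S S'' n :=
  hS ▸ h.mono hmn

theorem skip : Does .skip S S 1 := fun Λ M e next he v =>
  ⟨v, .step (by rw [Turing.TM2.step, he]; rfl)⟩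

theorem push (x : A) : Does (.push k x) S (Function.update S k (x :: S k)) 1 :=
  fun Λ M e next he v => ⟨v, .step (by rw [Turing.TM2.step, he]; rfl)⟩

theorem pop {P : Option A → Prog K A}
    (h : Does (P (S k).head?) (Function.update S k (S k).tail) S' n) :
    Does (.pop k P) S S' (n + 1) := fun Λ M e next he v =>
  (h Λ M (fun l => e (some ⟨_, l⟩)) next (fun _ => he _) _).imp fun _ h =>
    .trans (.step (by rw [Turing.TM2.step, he]; rfl)) h

theorem seq (h : Does P S S' m) (h' : Does Q S' S'' n) : Does (.seq P Q) S S'' (m + n) :=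
  fun Λ M e next he v =>
  have ⟨v', h⟩ := h Λ M (fun l => e (.inl l)) (e (.inr Q.entry)) (fun _ => he _) v
  (h' Λ M (fun l => e (.inr l)) next (fun _ => he _) v').imp fun _ h' =>
    (h.trans h').mono (add_comm n m).le

theorem loop_nil {P : A → Prog K A} (hk : S k = []) : Does (.loop k P) S S 1 :=
  fun Λ M e next he v => ⟨none, .step (by
    rw [Turing.TM2.step, he]
    simp [Prog.entry, Prog.code, hk])⟩

theorem loop_cons {P : A → Prog K A} {x : A} {l : List A} (hk : S k = x :: l)
    (h : Does (P x) (Function.update S k l) S' m) (h' : Does (.loop k P) S' S'' n) :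
    Does (.loop k P) S S'' (m + n + 1) := fun Λ M e next he v =>
  have ⟨v', h⟩ := h Λ M (fun l => e (some ⟨x, l⟩)) (e none) (fun _ => he _) (some x)
  (h' Λ M e next he v').imp fun _ h' =>
    ((Reaches.step (by
      rw [Turing.TM2.step, he]
      simp [Prog.entry, Prog.code, hk])).trans (h.trans h')).mono (by omega)

end Does

namespace Prog

section Machine

variable [Fintype K] [Fintype A]

/-- The machine that runs `P` on the input stack `i` and then returns the stack `o`. -/
def machine (P : Prog K A) (i o : K) : Turing.FinTM2 where
  K := K
  k₀ := i
  k₁ := o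
  Γ := fun _ => A
  Λ := Option P.Label
  main := some P.entry
  σ := Option A
  initialState := none
  m
    | none => .load (fun _ => none) .halt
    | some l => P.code some none l

theorem initList_machine (P : Prog K A) (i o : K) (w : List A) :
    Turing.initList (P.machine i o) w =
      ⟨some (some P.entry), none, Function.update (fun _ => []) i w⟩ := by
  refine congrArg (Turing.TM2.Cfg.mk (Γ := fun _ : K => A) (Λ := Option P.Label)
    (some (some P.entry)) none) (funext fun k : K => ?_)
  rcases eq_or_ne k i with rfl | h
  · exact (dif_pos rfl).trans (Function.update_self (β := fun _ : K => List A) k w fun _ => []).symm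
  · exact (dif_neg h).trans (Function.update_of_ne (β := fun _ : K => List A) h w fun _ => []).symm

theorem haltList_machine (P : Prog K A) (i o : K) (w : List A) :
    Turing.haltList (P.machine i o) w = ⟨none, none, Function.update (fun _ => []) o w⟩ := by
  refine congrArg (Turing.TM2.Cfg.mk (Γ := fun _ : K => A) (Λ := Option P.Label) none none)
    (funext fun k : K => ?_)
  rcases eq_or_ne k o with rfl | h
  · exact (dif_pos rfl).trans (Function.update_self (β := fun _ : K => List A) k w fun _ => []).symm
  · exact (dif_neg h).trans (Function.update_of_ne (β := fun _ : K => List A) h w fun _ => []).symm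

theorem outputsInTime_machine (P : Prog K A) {i o : K} {u w : List A} {n : ℕ}
    (h : Does P (Function.update (fun _ => []) i u) (Function.update (fun _ => []) o w) n) :
    Nonempty (Turing.TM2OutputsInTime (P.machine i o) u (some w) (n + 1)) := by
  obtain ⟨v, h⟩ := h (Option P.Label) (P.machine i o).m some none (fun _ => rfl) none
  have halt : Reaches (P.machine i o).m
      ⟨some none, v, Function.update (fun _ => []) o w⟩
      ⟨none, none, Function.update (fun _ => []) o w⟩ 1 := .step rfl
  have run : Reaches (P.machine i o).m (Turing.initList (P.machine i o) u)
      (Turing.haltList (P.machine i o) w) (1 + n) :=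
    initList_machine P i o u ▸ haltList_machine P i o w ▸ h.trans halt
  rwa [add_comm] at run

end Machine

theorem computableInPolyTime [Finite K] [Finite A] {α β : Type} {ea : α → List A}
    {eb : β → List A} {f : α → β} (P : Prog K A) (i o : K) (T : Polynomial ℕ)
    (h : ∀ a, Does P (Function.update (fun _ => []) i (ea a))
      (Function.update (fun _ => []) o (eb (f a))) (T.eval (ea a).length)) :
    Nonempty (Turing.TM2ComputableInPolyTime ea eb f) :=
  have := Fintype.ofFinite K
  have := Fintype.ofFinite A
  ⟨{ tm := P.machine i o
     inputAlphabet := .refl A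
     outputAlphabet := .refl A
     time := T + 1
     outputsFun := fun a => by
      have map_refl (w : List A) : w.map (Equiv.refl A).invFun = w := w.map_id
      have outputs := (P.outputsInTime_machine (h a)).some
      refine cast (congrArg₂ (fun u w => Turing.TM2OutputsInTime (P.machine i o) u (some w) _)
        (map_refl (ea a)).symm (map_refl (eb (f a))).symm) ?_
      simpa using outputs }⟩

end Prog

end StackProgram

/-! ### Arithmetic on stacks of binary digits -/

namespace StackProgram

theorem encodePosNum_eq_bits (p : PosNum) : encodePosNum p = (p : ℕ).bits := by
  induction p with
  | one => simp [encodePosNum]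
  | bit0 p ih =>
    rw [encodePosNum, ih, PosNum.cast_bit0, ← two_mul, Nat.bit0_bits _ p.cast_pos.ne']
  | bit1 p ih => rw [encodePosNum, ih, PosNum.cast_bit1, ← two_mul, Nat.bit1_bits]

theorem encodeNat_eq_bits (n : ℕ) : encodeNat n = n.bits := by
  rw [encodeNat]
  rcases h : (n : Num) with _ | p
  · rw [← Num.to_of_nat n, h]; simp [encodeNum]
  · rw [← Num.to_of_nat n, h]; exact encodePosNum_eq_bits p

/-- The binary numeral of `n`, least significant bit first. -/
def numeral (n : ℕ) : List Γ' := (encodeNat n).map Γ'.bit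

@[simp] theorem numeral_zero : numeral 0 = [] := rfl

theorem numeral_length (n : ℕ) : (numeral n).length = n.size := by
  rw [numeral, List.length_map, encodeNat_eq_bits, Nat.size_eq_bits_len]

theorem numeral_length_le {n B : ℕ} (hn : n < 2 ^ B) : (numeral n).length ≤ B := by
  rw [numeral_length]
  exact Nat.size_le.mpr hn

theorem numeral_eq_cons {n : ℕ} (hn : n ≠ 0) :
    numeral n = .bit n.bodd :: numeral (n / 2) := by
  have bits_ne_nil : n.bits ≠ [] := by
    simpa [← List.length_eq_zero_iff, Nat.size_eq_bits_len, Nat.size_eq_zero] using hn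
  obtain ⟨b, l, hbl⟩ := List.exists_cons_of_ne_nil bits_ne_nil
  have hb := n.bodd_eq_bits_head
  have hl := n.div2_bits_eq_tail
  simp_all [numeral, encodeNat_eq_bits, Nat.div2_val]

theorem numeral_tail (n : ℕ) : (numeral n).tail = numeral (n / 2) := by
  rcases eq_or_ne n 0 with rfl | hn
  · rfl
  · rw [numeral_eq_cons hn, List.tail_cons]

theorem numeral_two_mul {n : ℕ} (hn : n ≠ 0) : numeral (2 * n) = .bit false :: numeral n := by
  simp [numeral_eq_cons (n := 2 * n) (by simpa using hn), Nat.bodd_mul]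

namespace Prog

variable {K : Type}

/-- Moves the stack `a` to the stack `b`, which reverses the order of its symbols. -/
def move (a b : K) : Prog K Γ' := loop a fun x => push b x

/-- Empties the stack `a`. -/
def clear (a : K) : Prog K Γ' := loop a fun _ => skip

/-- Puts a copy of the stack `a` on top of the stack `b`; the stack `t` is temporary. -/
def copy (a b t : K) : Prog K Γ' :=
  (move a t).seq (loop t fun x => (push a x).seq (push b x))

/-- Doubles the number on the stack `a`. -/
def double (a : K) : Prog K Γ' :=
  pop a fun
    | none => skip
    | some x => (push a x).seq (push a (.bit false))

/-- One digit of the addition of `a` and `b`, where `d` is the carry; the digit of the sum goes to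
`t`, and the next carry to `c`, unless the addition is complete. -/
def addDigit (a b t c : K) (d : Γ') : Prog K Γ' :=
  pop a fun x => pop b fun y =>
    let isOne (z : Option Γ') : Bool := z = some (.bit true)
    if x = none ∧ y = none then
      if d = .bit true then push t (.bit true) else skip
    else
      (push t (.bit (isOne x ^^ isOne y ^^ isOne d))).seq
        (push c (.bit (Bool.atLeastTwo (isOne x) (isOne y) (isOne d))))

/-- Adds the number on the stack `b` to the number on the stack `a` and empties `b`; the stacks `t`
and `c` are temporary. -/
def add (a b t c : K) : Prog K Γ' :=
  (push c (.bit false)).seq ((loop c (addDigit a b t c)).seq (move t a))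

/-- Horner's rule: the stack `b` holds the digits of a number, most significant digit first, and for
each of them the number on the stack `p` is doubled, and increased by the number on the stack `a` if
the digit is one. The stacks `w`, `t` and `c` are temporary. -/
def horner (p a b w t c : K) : Prog K Γ' :=
  loop b fun d =>
    (double p).seq (if d = .bit true then (copy a w t).seq (add p w t c) else skip)

/-- Increases the number on the stack `c` by the product of the numbers on the stacks `a` and `b`;
the stacks `y`, `p`, `w`, `t` and `u` are temporary. -/
def addMul (c a b y p w t u : K) : Prog K Γ' :=
  (copy b u t).seq <| (move u y).seq <| (horner p a y w t u).seq <| add c p t u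

end Prog

open Prog Function

variable {K : Type} [DecidableEq K] {a b t c p w : K} {S : K → List Γ'} {n m B : ℕ}

theorem does_move (hab : a ≠ b) (S : K → List Γ') :
    Does (move a b) S (update (update S b ((S a).reverse ++ S b)) a [])
      (2 * (S a).length + 1) := by
  induction h : S a generalizing S with
  | nil => exact (Does.loop_nil h).congr (by grind [update_apply]) (by simp)
  | cons x l ih =>
    refine (Does.loop_cons h (.push x) (ih _ ?_)).congr ?_ ?_
    · grind [update_apply]
    · grind [update_apply]
    · grind

theorem does_clear (a : K) (S : K → List Γ') :
    Does (clear a) S (update S a []) (2 * (S a).length + 1) := by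
  induction h : S a generalizing S with
  | nil => exact (Does.loop_nil h).congr (by grind [update_apply]) (by simp)
  | cons x l ih =>
    refine (Does.loop_cons h .skip (ih (update S a l) ?_)).congr ?_ ?_
    · grind [update_apply]
    · grind [update_apply]
    · grind

theorem does_copy (hd : [a, b, t].Nodup) (ht : S t = []) :
    Does (copy a b t) S (update S b (S a ++ S b)) (5 * (S a).length + 2) := by
  have restore (l : List Γ') (S : K → List Γ') (hl : S t = l) :
      Does (loop t fun x => (push a x).seq (push b x)) S
        (update (update (update S a (l.reverse ++ S a)) b (l.reverse ++ S b)) t [])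
        (3 * l.length + 1) := by
    induction l generalizing S with
    | nil => exact (Does.loop_nil hl).congr (by grind [update_apply]) (by simp)
    | cons x l ih =>
      refine (Does.loop_cons hl (.seq (.push x) (.push x)) (ih _ ?_)).congr ?_ ?_
      · grind [update_apply]
      · grind [update_apply]
      · grind
  refine ((does_move (by grind) S).seq (restore (S a).reverse _ ?_)).congr ?_ ?_
  · grind [update_apply]
  · grind [update_apply]
  · grind

theorem does_double (ha : S a = numeral n) :
    Does (double a) S (update S a (numeral (2 * n))) 3 := by
  rcases eq_or_ne n 0 with rfl | hn
  · refine (Does.pop (n := 1) ?_).congr rfl (by norm_num)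
    have hS : update S a [] = S := by simp [← numeral_zero, ← ha]
    simpa [ha, hS] using Does.skip
  · refine (Does.pop (n := 2) ?_).congr rfl le_rfl
    rw [numeral_two_mul hn, ha, numeral_eq_cons hn]
    refine (Does.seq (.push _) (.push _)).congr ?_ le_rfl
    grind [update_apply]

theorem does_addDigit_zero (ha : S a = []) (hb : S b = []) (d : Bool) :
    Does (addDigit a b t c (.bit d)) S (update S t (numeral d.toNat ++ S t)) 3 := by
  have hS (k : K) (hk : S k = []) : update S k [] = S := by simp [← hk]
  refine Does.pop (Does.pop ?_)
  simp only [ha, hS, hb, List.head?_nil, List.tail_nil, and_self, if_true, Γ'.bit.injEq]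
  cases d
  · exact Does.skip.congr (by simp) le_rfl
  · exact Does.push _

theorem does_addDigit (hd : [a, b, t, c].Nodup) (ha : S a = numeral n) (hb : S b = numeral m)
    (h : n ≠ 0 ∨ m ≠ 0) (d : Bool) :
    Does (addDigit a b t c (.bit d)) S
      (update (update (update (update S a (numeral (n / 2))) b (numeral (m / 2)))
        t (.bit (n + m + d.toNat).bodd :: S t))
        c (.bit (Bool.atLeastTwo n.bodd m.bodd d) :: S c)) 4 := by
  have isOne_head (k : ℕ) :
      decide ((numeral k).head? = some (.bit true)) = k.bodd := by
    rcases eq_or_ne k 0 with rfl | hk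
    · rfl
    · simp [numeral_eq_cons hk]
  have head_eq_none (k : ℕ) : (numeral k).head? = none ↔ k = 0 := by
    rcases eq_or_ne k 0 with rfl | hk
    · simp
    · simp [numeral_eq_cons hk, hk]
  have hba : update S a (numeral (n / 2)) b = numeral m := by grind [update_apply]
  refine Does.pop (Does.pop ?_)
  rw [ha, numeral_tail, hba, numeral_tail]
  simp only [isOne_head, head_eq_none, if_neg (not_and_or.mpr h), Option.some.injEq, Γ'.bit.injEq,
    Bool.decide_eq_true, Nat.bodd_add, show d.toNat.bodd = d by cases d <;> rfl]
  refine ((Does.push _).seq (.push _)).congr ?_ le_rfl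
  grind [update_apply]

theorem does_loop_addDigit_zero (hd : [a, b, t, c].Nodup) (ha : S a = []) (hb : S b = [])
    {d : Bool} (hc : S c = [.bit d]) :
    Does (loop c (addDigit a b t c)) S
      (update (update (update (update S a []) b []) c [])
        t ((numeral d.toNat).reverse ++ S t)) 5 := by
  have htc : t ≠ c := by grind
  have hS (k : K) (hk : S k = []) : update S k [] = S := by simp [← hk]
  refine (Does.loop_cons hc (does_addDigit_zero ?_ ?_ d) (.loop_nil ?_)).congr ?_ le_rfl
  · grind [update_apply]
  · grind [update_apply]
  · grind [update_apply]
  · rw [hS a ha, hS b hb, update_of_ne htc]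
    cases d <;> rfl

theorem half_add_add_carry (n m : ℕ) (d : Bool) :
    (n + m + d.toNat) / 2 = n / 2 + m / 2 + (Bool.atLeastTwo n.bodd m.bodd d).toNat := by
  have hn := Nat.mod_two_of_bodd n
  have hm := Nat.mod_two_of_bodd m
  cases d <;> cases hn' : n.bodd <;> cases hm' : m.bodd <;> simp_all [Bool.atLeastTwo] <;> omega

theorem does_loop_addDigit (hd : [a, b, t, c].Nodup) (ha : S a = numeral n) (hb : S b = numeral m)
    {d : Bool} (hc : S c = [.bit d]) (hB : n + m + d.toNat < 2 ^ B) :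
    Does (loop c (addDigit a b t c)) S
      (update (update (update (update S a []) b []) c [])
        t ((numeral (n + m + d.toNat)).reverse ++ S t)) (5 * B + 5) := by
  induction B generalizing n m d S with
  | zero =>
    obtain ⟨rfl, rfl⟩ : n = 0 ∧ m = 0 := by omega
    exact (does_loop_addDigit_zero hd ha hb hc).congr (by simp) (by omega)
  | succ B ih =>
    by_cases h : n ≠ 0 ∨ m ≠ 0
    · have half := half_add_add_carry n m d
      refine (Does.loop_cons hc (does_addDigit hd (n := n) (m := m) ?_ ?_ h d)
        (ih (n := n / 2) (m := m / 2) (d := Bool.atLeastTwo n.bodd m.bodd d) ?_ ?_ ?_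
          (by omega))).congr ?_ (by omega)
      · grind [update_apply]
      · grind [update_apply]
      · grind [update_apply]
      · grind [update_apply]
      · grind [update_apply]
      · rw [numeral_eq_cons (n := n + m + d.toNat) (by omega), half]
        have hat : t ≠ a ∧ t ≠ b ∧ t ≠ c := by grind
        ext1 k
        rcases eq_or_ne k t with rfl | hk
        · simp [hat]
        · simp only [update_apply, hk, if_false]
          split_ifs <;> rfl
    · obtain ⟨rfl, rfl⟩ : n = 0 ∧ m = 0 := by omega
      exact (does_loop_addDigit_zero hd ha hb hc).congr (by simp) (by omega)

theorem does_add (hd : [a, b, t, c].Nodup) (ht : S t = []) (hc : S c = []) (ha : S a = numeral n)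
    (hb : S b = numeral m) (hB : n + m < 2 ^ B) :
    Does (add a b t c) S (update (update S a (numeral (n + m))) b []) (7 * B + 7) := by
  have hta : t ≠ a := by grind
  refine ((Does.push _).seq ((does_loop_addDigit hd (n := n) (m := m) (d := false) ?_ ?_ ?_ hB).seq
    (does_move hta _))).congr ?_ ?_
  · grind [update_apply]
  · grind [update_apply]
  · grind [update_apply]
  · simp only [Bool.toNat_false, add_zero, update_self, List.reverse_append, List.reverse_reverse]
    generalize numeral (n + m) = l
    grind [update_apply]
  · have length_le := numeral_length_le hB
    simp only [update_self, List.length_append, List.length_reverse, Bool.toNat_false, add_zero]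
    grind [update_apply]

theorem does_hornerDigit (hd : [p, a, w, t, c].Nodup) (hw : S w = []) (ht : S t = [])
    (hc : S c = []) (ha : S a = numeral n) (hp : S p = numeral m) (d : Bool)
    (hB : 2 * m + d.toNat * n < 2 ^ B) :
    Does ((double p).seq (if Γ'.bit d = .bit true then (copy a w t).seq (add p w t c) else skip)) S
      (update S p (numeral (2 * m + d.toNat * n))) (12 * B + 12) := by
  cases d with
  | false =>
    simpa using ((does_double hp).seq .skip).mono (by omega)
  | true =>
    simp only [Bool.toNat_true, one_mul, if_true] at hB ⊢
    have hn : (numeral n).length ≤ B := numeral_length_le (by omega)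
    refine ((does_double hp).seq ((does_copy (by grind) ?_).seq
      (does_add (n := 2 * m) (m := n) (by grind) ?_ ?_ ?_ ?_ hB))).congr ?_ ?_
    · grind [update_apply]
    · grind [update_apply]
    · grind [update_apply]
    · grind [update_apply]
    · grind [update_apply]
    · generalize numeral (2 * m + n) = l
      grind [update_apply]
    · have : update S p (numeral (2 * m)) a = numeral n := by grind [update_apply]
      rw [this]
      omega

theorem le_foldl_bit (l : List Bool) (k : ℕ) : k ≤ l.foldl (fun k d => Nat.bit d k) k := by
  induction l generalizing k with
  | nil => rfl
  | cons d l ih => exact (by rw [Nat.bit_val]; omega : k ≤ Nat.bit d k).trans (ih _)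

theorem does_horner (hd : [p, a, b, w, t, c].Nodup) (hw : S w = []) (ht : S t = []) (hc : S c = [])
    (ha : S a = numeral n) {l : List Bool} (hb : S b = l.map .bit) {k : ℕ}
    (hp : S p = numeral (k * n)) (hB : l.foldl (fun k d => Nat.bit d k) k * n < 2 ^ B) :
    Does (horner p a b w t c) S
      (update (update S p (numeral (l.foldl (fun k d => Nat.bit d k) k * n))) b [])
      (l.length * (12 * B + 13) + 1) := by
  induction l generalizing S k with
  | nil =>
    have hpS : update S p (numeral (k * n)) = S := by simp [← hp]
    have hbS : update S b [] = S := by simp_all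
    exact (Does.loop_nil hb).congr (by simp [hpS, hbS]) (by simp)
  | cons d l ih =>
    have hk : 2 * (k * n) + d.toNat * n = Nat.bit d k * n := by rw [Nat.bit_val]; ring
    have hB' := (Nat.mul_le_mul_right n (le_foldl_bit l (Nat.bit d k))).trans_lt hB
    refine (Does.loop_cons hb
      (does_hornerDigit (n := n) (m := k * n) (by grind) ?_ ?_ ?_ ?_ ?_ d (hk ▸ hB'))
      (ih (k := Nat.bit d k) ?_ ?_ ?_ ?_ ?_ ?_ hB)).congr ?_
      (by rw [List.length_cons]; linarith)
    · grind [update_apply]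
    · grind [update_apply]
    · grind [update_apply]
    · grind [update_apply]
    · grind [update_apply]
    · grind [update_apply]
    · grind [update_apply]
    · grind [update_apply]
    · grind [update_apply]
    · grind [update_apply]
    · rw [hk, update_self]
    · grind [update_apply]

theorem foldl_bit_reverse_bits (n : ℕ) : n.bits.reverse.foldl (fun k d => Nat.bit d k) 0 = n := by
  rw [List.foldl_reverse]
  induction n using Nat.binaryRec' with
  | zero => rfl
  | bit d n h ih => rw [Nat.bits_append_bit n d h, List.foldr_cons, ih]

theorem does_addMul {y u : K} {k : ℕ} (hd : [y, p, w, t, u].Nodup) (ha : a ∉ [y, p, w, t, u])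
    (hb : b ∉ [y, p, w, t, u]) (hc : c ∉ [y, p, w, t, u]) (hS : ∀ x ∈ [y, p, w, t, u], S x = [])
    (han : S a = numeral n) (hbm : S b = numeral m) (hck : S c = numeral k)
    (hm : m < 2 ^ B) (hB : k + m * n < 2 ^ B) :
    Does (addMul c a b y p w t u) S (update S c (numeral (k + m * n))) (16 * (B + 1) ^ 2) := by
  have bits_m := foldl_bit_reverse_bits m
  have length_m := numeral_length_le hm
  have reverse_m : (numeral m).reverse = m.bits.reverse.map .bit := by
    rw [numeral, encodeNat_eq_bits, List.map_reverse]
  simp only [List.nodup_cons, List.mem_cons, List.not_mem_nil, or_false, not_or, forall_eq_or_imp,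
    forall_eq, List.nodup_nil, and_true, not_false_eq_true] at hd ha hb hc hS
  refine ((does_copy (t := t) (by grind) ?_).seq <| (does_move (by grind) _).seq <|
    (does_horner (l := m.bits.reverse) (k := 0) (n := n) (B := B) (by grind)
      ?_ ?_ ?_ ?_ ?_ ?_ ?_).seq
    (does_add (n := k) (m := m * n) (by grind) ?_ ?_ ?_ ?_ hB)).congr ?_ ?_
  · grind [update_apply]
  · grind [update_apply]
  · grind [update_apply]
  · grind [update_apply]
  · grind [update_apply]
  · grind [update_apply]
  · grind [update_apply, numeral_zero]
  · rw [bits_m]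
    omega
  · grind [update_apply]
  · grind [update_apply]
  · grind [update_apply]
  · grind [update_apply]
  · rw [bits_m]
    generalize numeral (k + m * n) = l
    grind [update_apply]
  · have length_bits : m.bits.reverse.length ≤ B := by
      rwa [List.length_reverse, ← encodeNat_eq_bits, ← List.length_map (f := Γ'.bit)]
    have length_u : (update S u (S b ++ S u) u).length ≤ B := by grind [update_apply]
    have length_b : (S b).length ≤ B := by rwa [hbm]
    nlinarith [Nat.mul_le_mul_right (12 * B + 13) length_bits]

end StackProgram

/-! ### Register machines with additions and multiplications -/

namespace StackProgram

open Prog Function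

/-- The stacks of a machine with registers `R`: an input stack, a stack for the reversed input, an
output stack, some temporary stacks, and a stack for each register. -/
inductive Stack (R : Type)
  | inp
  | rev
  | out
  | tmp (i : Fin 5)
  | reg (a : R)
  deriving DecidableEq, Fintype

variable {R : Type} {i v o : List Γ'} {r : R → ℕ} {B : ℕ}

/-- The contents of the stacks when the input, the reversed input and the output are `i`, `v` and
`o`, the register `a` holds the number `r a`, and the temporary stacks are empty. -/
def layout (i v o : List Γ') (r : R → ℕ) : Stack R → List Γ'
  | .inp => i
  | .rev => v
  | .out => o
  | .tmp _ => []
  | .reg a => numeral (r a)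

theorem layout_nil : layout [] [] [] (fun _ : R => 0) = fun _ => [] := by
  ext1 k; cases k <;> rfl

variable [DecidableEq R]

@[simp] theorem update_layout_inp (w : List Γ') :
    update (layout i v o r) .inp w = layout w v o r := by
  ext1 k; cases k <;> simp [layout]

@[simp] theorem update_layout_rev (w : List Γ') :
    update (layout i v o r) .rev w = layout i w o r := by
  ext1 k; cases k <;> simp [layout]

@[simp] theorem update_layout_out (w : List Γ') :
    update (layout i v o r) .out w = layout i v w r := by
  ext1 k; cases k <;> simp [layout]

@[simp] theorem update_layout_reg (a : R) (n : ℕ) :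
    update (layout i v o r) (.reg a) (numeral n) = layout i v o (update r a n) := by
  ext1 k; cases k <;> simp [layout, update_apply, apply_ite numeral]

@[simp] theorem update_layout_reg_nil (a : R) :
    update (layout i v o r) (.reg a) [] = layout i v o (update r a 0) :=
  update_layout_reg a 0

theorem does_add_reg {a b : R} (hab : a ≠ b) (hB : r a + r b < 2 ^ B) :
    Does (add (.reg a) (.reg b) (.tmp 0) (.tmp 1)) (layout i v o r)
      (layout i v o (update (update r a (r a + r b)) b 0)) (7 * B + 7) := by
  refine (does_add (n := r a) (m := r b) ?_ ?_ ?_ ?_ ?_ hB).congr ?_ le_rfl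
  · simpa using hab
  · rfl
  · rfl
  · rfl
  · rfl
  · simp

/-- An instruction of a register machine: `incr c` increases the register `c` by one, and
`addMul c a b` increases it by the product of the registers `a` and `b`. -/
inductive Instr (R : Type)
  | incr (c : R)
  | addMul (c a b : R)

namespace Instr

/-- The effect of an instruction on the registers. -/
def exec : Instr R → (R → ℕ) → R → ℕ
  | incr c, r => update r c (r c + 1)
  | addMul c a b, r => update r c (r c + r a * r b)

/-- The effect of a list of instructions on the registers. -/
def execAll (l : List (Instr R)) (r : R → ℕ) : R → ℕ := l.foldl (fun r I => I.exec r) r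

/-- The program for an instruction. -/
def prog : Instr R → Prog (Stack R) Γ'
  | incr c => (push (.tmp 0) (.bit true)).seq (Prog.add (.reg c) (.tmp 0) (.tmp 1) (.tmp 2))
  | addMul c a b =>
    Prog.addMul (.reg c) (.reg a) (.reg b) (.tmp 0) (.tmp 1) (.tmp 2) (.tmp 3) (.tmp 4)

/-- The program for a list of instructions. -/
def progAll : List (Instr R) → Prog (Stack R) Γ'
  | [] => skip
  | I :: l => I.prog.seq (progAll l)

theorem le_exec (I : Instr R) (r : R → ℕ) : r ≤ I.exec r := by
  cases I <;> simp [exec, le_update_self_iff]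

theorem le_execAll (l : List (Instr R)) (r : R → ℕ) : r ≤ execAll l r := by
  induction l generalizing r with
  | nil => exact le_rfl
  | cons I l ih => exact (I.le_exec r).trans (ih _)

theorem exec_lt (I : Instr R) (hr : ∀ a, r a < 2 ^ B) (a : R) : I.exec r a < 2 ^ (2 * B + 1) := by
  have pow_eq : 2 ^ (2 * B + 1) = 2 * (2 ^ B * 2 ^ B) := by ring
  rw [pow_eq]
  cases I with
  | incr c =>
    have ha := hr a
    have hc := hr c
    simp only [exec, update_apply]
    split_ifs <;> nlinarith
  | addMul c x y =>
    have ha := hr a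
    have hc := hr c
    have hxy := Nat.mul_lt_mul'' (hr x) (hr y)
    simp only [exec, update_apply]
    split_ifs <;> nlinarith

theorem execAll_lt (l : List (Instr R)) (hr : ∀ a, r a < 2 ^ B) (a : R) :
    execAll l r a < 2 ^ (2 ^ l.length * (B + 1)) := by
  induction l generalizing r B with
  | nil => exact (hr a).trans_le (Nat.pow_le_pow_right two_pos (by simp))
  | cons I l ih =>
    refine (ih (I.exec_lt hr)).trans_eq ?_
    rw [List.length_cons]
    ring

theorem execAll_append (l l' : List (Instr R)) (r : R → ℕ) :
    execAll (l ++ l') r = execAll l' (execAll l r) :=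
  List.foldl_append

theorem execAll_replicate_incr (n : ℕ) (c : R) (r : R → ℕ) :
    execAll (.replicate n (incr c)) r = update r c (r c + n) := by
  induction n generalizing r with
  | zero => simp [execAll]
  | succ n ih =>
    rw [List.replicate_succ]
    refine (ih _).trans ?_
    simp [exec, add_assoc, add_comm 1]

theorem does_prog (I : Instr R) (hr : ∀ a, r a < 2 ^ B) (hI : ∀ a, I.exec r a < 2 ^ B) :
    Does I.prog (layout i v o r) (layout i v o (I.exec r)) (16 * (B + 1) ^ 2) := by
  cases I with
  | incr c =>
    have hB : r c + 1 < 2 ^ B := by simpa [exec] using hI c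
    refine ((Does.push _).seq (does_add (n := r c) (m := 1) (by simp) rfl rfl rfl rfl hB)).congr
      ?_ (by nlinarith)
    have tmp_nil : update (layout i v o r) (.tmp 0) [] = layout i v o r := update_eq_self _ _
    rw [update_comm (by simp), update_idem, tmp_nil, update_layout_reg, exec]
  | addMul c a b =>
    have hB : r c + r b * r a < 2 ^ B := by simpa [exec, mul_comm (r b)] using hI c
    refine (does_addMul (n := r a) (m := r b) (k := r c) (by simp : [(.tmp 0 : Stack R), .tmp 1,
      .tmp 2, .tmp 3, .tmp 4].Nodup) (by simp) (by simp) (by simp) (by simp [layout]) rfl rfl rfl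
      (hr b) hB).congr ?_ le_rfl
    rw [update_layout_reg, mul_comm, exec]

theorem does_progAll (l : List (Instr R)) (hB : ∀ a, execAll l r a < 2 ^ B) :
    Does (progAll l) (layout i v o r) (layout i v o (execAll l r))
      (l.length * (16 * (B + 1) ^ 2) + 1) := by
  induction l generalizing r with
  | nil => exact Does.skip.congr rfl (by simp)
  | cons I l ih =>
    have hI (a : R) : I.exec r a < 2 ^ B := (le_execAll l _ a).trans_lt (hB a)
    refine ((I.does_prog (fun a => (I.le_exec r a).trans_lt (hI a)) hI).seq (ih hB)).mono ?_
    rw [List.length_cons]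
    linarith

end Instr

/-- Writes the number in the register `a`, followed by a comma, in front of the output. -/
def emit (a : R) : Prog (Stack R) Γ' :=
  (push .out .comma).seq (copy (.reg a) .out (.tmp 0))

/-- Writes the numbers in the registers `l` in front of the output. -/
def emitAll : List R → Prog (Stack R) Γ'
  | [] => skip
  | a :: l => (emitAll l).seq (emit a)

/-- Sets the registers `l` to zero. -/
def clearAll : List R → Prog (Stack R) Γ'
  | [] => skip
  | a :: l => (clear (.reg a)).seq (clearAll l)

theorem does_emit (a : R) (ha : r a < 2 ^ B) :
    Does (emit a) (layout i v o r) (layout i v (numeral (r a) ++ .comma :: o) r) (5 * B + 3) := by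
  have length_le := numeral_length_le ha
  refine ((Does.push _).seq (does_copy (by simp) ?_)).congr ?_ ?_
  · simp [layout]
  · simp [layout]
  · simp only [update_layout_out, layout]
    omega

theorem does_clearAll (l : List R) (hB : ∀ a, r a < 2 ^ B) :
    Does (clearAll l) (layout i v o r) (layout i v o fun a => if a ∈ l then 0 else r a)
      (l.length * (2 * B + 1) + 1) := by
  induction l generalizing r with
  | nil => exact Does.skip.congr (by simp) (by simp)
  | cons a l ih =>
    have length_le := numeral_length_le (hB a)
    have hB' (b : R) : update r a 0 b < 2 ^ B :=
      (update_le_self_iff.mpr (r a).zero_le b).trans_lt (hB b)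
    refine ((does_clear _ _).seq (update_layout_reg_nil (r := r) a ▸ ih hB')).congr ?_ ?_
    · congr 1
      ext1 b
      by_cases b = a <;> simp_all
    · rw [List.length_cons, layout]
      linarith

theorem does_emitAll (l : List R) (hB : ∀ a, r a < 2 ^ B) :
    Does (emitAll l) (layout i v o r) (layout i v (ParetoCover.encodeNats (l.map r) ++ o) r)
      (l.length * (5 * B + 3) + 1) := by
  induction l generalizing o with
  | nil => exact Does.skip.congr rfl (by simp)
  | cons a l ih =>
    refine (ih.seq (does_emit a (hB a))).congr ?_ ?_
    · simp [ParetoCover.encodeNats, numeral]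
    · rw [List.length_cons]
      linarith

end StackProgram

/-! ### Reading a list of numbers -/

namespace StackProgram

open Prog Function ParetoCover

/-- Processes a symbol in `readNumbers`. -/
def readSymbol {K : Type} (x : K) (P : Prog K Γ') : Γ' → Prog K Γ'
  | .bit b => push x (.bit b)
  | _ => P

/-- Reads the reversed encoding of a list of numbers from the stack `k`, hence the last number
first. Every number except the last one to be read is put on the stack `x` and processed by `P`,
which has to empty `x`; the last one is left on `x`. -/
def readNumbers {K : Type} (k x : K) (P : Prog K Γ') : Prog K Γ' :=
  pop k fun _ => loop k (readSymbol x P)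

theorem encodeNats_append (l l' : List ℕ) :
    encodeNats (l ++ l') = encodeNats l ++ encodeNats l' :=
  List.flatMap_append

theorem reverse_encodeNats_concat (l : List ℕ) (a : ℕ) :
    (encodeNats (l ++ [a])).reverse =
      .comma :: ((numeral a).reverse ++ (encodeNats l).reverse) := by
  simp [encodeNats, numeral]

theorem exists_reverse_encodeNats_cons (t : ℕ) (l : List ℕ) :
    ∃ w, (encodeNats (t :: l)).reverse = .comma :: w := by
  rcases List.eq_nil_or_concat' (t :: l) with h | ⟨l', a, h⟩
  · simp at h
  · exact ⟨_, h ▸ reverse_encodeNats_concat l' a⟩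

variable {K : Type} [DecidableEq K] {k x : K} {P : Prog K Γ'} {S S' : K → List Γ'} {n : ℕ}

theorem does_loop_readBits (hkx : k ≠ x) {w : List Γ'} (l : List Bool)
    (hk : S k = l.map .bit ++ w)
    (h : Does (loop k (readSymbol x P))
      (update (update S k w) x ((l.map .bit).reverse ++ S x)) S' n) :
    Does (loop k (readSymbol x P)) S S' (n + 2 * l.length) := by
  induction l generalizing S with
  | nil =>
    rw [List.map_nil, List.nil_append] at hk
    simpa [← hk] using h
  | cons b l ih =>
    have read : Does (readSymbol x P (.bit b)) (update S k (l.map .bit ++ w)) _ 1 := .push _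
    refine (Does.loop_cons hk read (ih (S := update _ x _) ?_ ?_)).mono (by grind)
    · grind [update_apply]
    · convert h using 1
      grind [update_apply]

theorem does_loop_readNumeral (hkx : k ≠ x) {w : List Γ'} {a : ℕ}
    (hk : S k = (numeral a).reverse ++ w) (hx : S x = [])
    (h : Does (loop k (readSymbol x P))
      (update (update S k w) x (numeral a)) S' n) :
    Does (loop k (readSymbol x P)) S S' (n + 2 * (numeral a).length) := by
  have map_reverse : (numeral a).reverse = (encodeNat a).reverse.map .bit := by
    rw [numeral, List.map_reverse]
  refine (does_loop_readBits (n := n) hkx (encodeNat a).reverse (w := w) (map_reverse ▸ hk) ?_).mono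
    (by simp [numeral])
  rwa [← map_reverse, List.reverse_reverse, hx, List.append_nil]

theorem does_loop_readNumbers (hkx : k ≠ x) {L : List ℕ} (T : List ℕ → K → List Γ')
    (hT : ∀ q, T q x = [])
    (h : ∀ a q w, a :: q <:+ L →
      Does P (update (update (T q) k w) x (numeral a)) (update (T (a :: q)) k w) n)
    (t : ℕ) {l q : List ℕ} (hl : l ++ q = L) {w : List Γ'}
    (hw : (encodeNats (t :: l)).reverse = .comma :: w) :
    Does (loop k (readSymbol x P)) (update (T q) k w)
      (update (update (T L) k []) x (numeral t)) (w.length * (n + 2) + 1) := by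
  induction l using List.reverseRecOn generalizing q w with
  | nil =>
    rw [← List.nil_append [t], reverse_encodeNats_concat] at hw
    obtain rfl : w = (numeral t).reverse ++ [] := by simpa [encodeNats, eq_comm] using hw
    obtain rfl : q = L := hl
    refine (does_loop_readNumeral hkx (a := t) (w := []) ?_ ?_ (.loop_nil ?_)).congr ?_ ?_
    · grind [update_apply]
    · grind [update_apply]
    · grind [update_apply]
    · grind [update_apply]
    · simp only [List.length_append, List.length_reverse, List.length_nil]
      nlinarith
  | append_singleton l a ih =>
    rw [← List.cons_append, reverse_encodeNats_concat] at hw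
    obtain ⟨v, hv⟩ := exists_reverse_encodeNats_cons t l
    obtain rfl : w = (numeral a).reverse ++ .comma :: v := by rw [← hv]; simpa [eq_comm] using hw
    have hL : l ++ a :: q = L := by simpa using hl
    have process : Does (readSymbol x P .comma) _ _ n := h a q v ⟨l, hL⟩
    refine (does_loop_readNumeral hkx (a := a) (w := .comma :: v) ?_ ?_
      (.loop_cons (l := v) (x := .comma) ?_ (m := n) ?_ (ih hL hv))).mono ?_
    · grind [update_apply]
    · grind [update_apply]
    · grind [update_apply]
    · convert process using 1
      grind [update_apply]
    · simp only [List.length_append, List.length_reverse, List.length_cons]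
      nlinarith

theorem does_readNumbers (hkx : k ≠ x) (T : List ℕ → K → List Γ') (hT : ∀ q, T q x = [])
    (t : ℕ) (l : List ℕ)
    (h : ∀ a q w, a :: q <:+ l →
      Does P (update (update (T q) k w) x (numeral a)) (update (T (a :: q)) k w) n) :
    Does (readNumbers k x P) (update (T []) k (encodeNats (t :: l)).reverse)
      (update (update (T l) k []) x (numeral t))
      ((encodeNats (t :: l)).length * (n + 2) + 2) := by
  obtain ⟨w, hw⟩ := exists_reverse_encodeNats_cons t l
  have length_w : (encodeNats (t :: l)).length = w.length + 1 := by
    rw [← List.length_reverse, hw, List.length_cons]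
  have loop := does_loop_readNumbers hkx T hT h t l.append_nil hw
  refine (Does.pop (n := w.length * (n + 2) + 1) ?_).mono (by rw [length_w]; nlinarith)
  rw [hw]
  simpa using loop

end StackProgram

/-! ### The reduction -/

namespace ParetoCover

namespace NumberPartitioningInstance

variable (I : NumberPartitioningInstance)

/-- The sum of all numbers. -/
def sum : ℕ := ∑ i, I.a i

theorem sum_pos : 0 < I.sum :=
  Finset.sum_pos (fun i _ => I.a_pos i) ⟨⟨0, I.m_pos⟩, Finset.mem_univ _⟩

theorem le_sum (i : Fin I.m) : I.a i ≤ I.sum :=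
  Finset.single_le_sum (f := I.a) (fun _ _ => Nat.zero_le _) (Finset.mem_univ i)

/-- The large number `M` of the reduction. -/
def big : ℕ := 13 * I.sum ^ 2

theorem big_pos : 0 < I.big := by
  have := I.sum_pos
  unfold big
  positivity

theorem sum_le_big : I.sum ≤ I.big := by
  have := I.sum_pos
  unfold big
  nlinarith

/-- The instance of the binary Pareto cover problem that belongs to an instance of
NUMBER PARTITIONING. -/
def toPareto : BinaryParetoInstance where
  n := I.m + 1
  k := I.t + 2
  γ := ⟨(I.sum ^ 2 * I.big + 6 * I.t : ℕ), I.t * I.big ^ 5,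
    Nat.mul_pos I.t_pos (pow_pos I.big_pos 5)⟩
  p := Fin.snoc (α := fun _ => Fraction) (fun i => ⟨I.a i, I.big ^ 4, pow_pos I.big_pos 4⟩)
    ⟨1, I.big ^ 6, pow_pos I.big_pos 6⟩
  c := Fin.snoc (α := fun _ => Fraction) (fun i => ⟨I.a i, 1, one_pos⟩)
    ⟨(2 * I.big : ℕ), 1, one_pos⟩
  k_pos := by omega
  p_mem i := by
    have one_le_big : (1 : ℚ) ≤ I.big := by exact_mod_cast I.big_pos
    refine Fin.lastCases ?_ (fun i => ?_) i
    · simp only [Fin.snoc_last, Fraction.val, Set.mem_Icc]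
      push_cast
      exact ⟨by positivity, div_le_one_of_le₀ (one_le_pow₀ one_le_big) (by positivity)⟩
    · simp only [Fin.snoc_castSucc, Fraction.val, Set.mem_Icc]
      push_cast
      have a_le_big : (I.a i : ℚ) ≤ I.big := by exact_mod_cast (I.le_sum i).trans I.sum_le_big
      exact ⟨by positivity, div_le_one_of_le₀
        (a_le_big.trans (le_self_pow₀ one_le_big (by norm_num))) (by positivity)⟩
  c_nonneg i := by
    refine Fin.lastCases ?_ (fun i => ?_) i
    · simp only [Fin.snoc_last, Fraction.val]
      positivity
    · simp only [Fin.snoc_castSucc, Fraction.val]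
      positivity

theorem encode_toPareto :
    I.toPareto.encode = encodeNats ([I.t + 2, 0, I.sum ^ 2 * I.big + 6 * I.t, I.t * I.big ^ 5] ++
      (List.ofFn I.a).flatMap (fun a => [0, a, I.big ^ 4, 0, a, 1]) ++
        [0, 1, I.big ^ 6, 0, 2 * I.big, 1]) := by
  let block (i : Fin (I.m + 1)) : List ℕ := (I.toPareto.p i).toNats ++ (I.toPareto.c i).toNats
  have blocks : List.ofFn block = (List.ofFn I.a).map (fun a => [0, a, I.big ^ 4, 0, a, 1]) ++
      [[0, 1, I.big ^ 6, 0, 2 * I.big, 1]] := by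
    rw [List.ofFn_succ', List.map_ofFn, List.concat_eq_append]
    simp only [block, toPareto, Fin.snoc_castSucc, Fin.snoc_last]
    rfl
  have flatten_blocks : (List.ofFn block).flatten =
      (List.ofFn I.a).flatMap (fun a => [0, a, I.big ^ 4, 0, a, 1]) ++
        [0, 1, I.big ^ 6, 0, 2 * I.big, 1] := by
    rw [blocks, List.flatten_append, List.flatMap_def, List.flatten_singleton]
  rw [BinaryParetoInstance.encode, List.append_assoc, ← flatten_blocks]
  rfl

end NumberPartitioningInstance

/-! ### A polynomial-time machine for the reduction -/

namespace Reduction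

open StackProgram Prog Instr Function

/-- The registers of the machine for the reduction. -/
inductive Reg
  | cur | zero | one | two | six | thirteen | t | s | s2 | m | m2 | m4 | m5 | m6 | c | d | g | k
  deriving DecidableEq

instance : Fintype Reg :=
  .ofList [.cur, .zero, .one, .two, .six, .thirteen, .t, .s, .s2, .m, .m2, .m4, .m5, .m6, .c, .d,
    .g, .k] fun a => by cases a <;> decide

/-- The numbers computed by the machine, as functions of the number `t` and the sum `s`; the
register `cur` holds the number that is being read. -/
def values (t s : ℕ) : Reg → ℕ
  | .cur => 0
  | .zero => 0
  | .one => 1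
  | .two => 2
  | .six => 6
  | .thirteen => 13
  | .t => t
  | .s => s
  | .s2 => s ^ 2
  | .m => 13 * s ^ 2
  | .m2 => (13 * s ^ 2) ^ 2
  | .m4 => (13 * s ^ 2) ^ 4
  | .m5 => (13 * s ^ 2) ^ 5
  | .m6 => (13 * s ^ 2) ^ 6
  | .c => 2 * (13 * s ^ 2)
  | .d => t * (13 * s ^ 2) ^ 5
  | .g => s ^ 2 * (13 * s ^ 2) + 6 * t
  | .k => t + 2

/-- The instructions that compute `values t s` from `t` and `s`. -/
def instrs : List (Instr Reg) :=
  .replicate 1 (incr .one) ++ .replicate 2 (incr .two) ++ .replicate 6 (incr .six) ++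
    .replicate 13 (incr .thirteen) ++
    [.addMul .s2 .s .s, .addMul .m .thirteen .s2, .addMul .m2 .m .m, .addMul .m4 .m2 .m2,
      .addMul .m5 .m4 .m, .addMul .m6 .m5 .m, .addMul .c .two .m, .addMul .d .t .m5,
      .addMul .g .s2 .m, .addMul .g .six .t, .addMul .k .t .one, .addMul .k .two .one]

theorem execAll_instrs (t s : ℕ) :
    execAll instrs (update (update (fun _ => 0) .s s) .t t) = values t s := by
  simp only [instrs, execAll_append, execAll_replicate_incr]
  ext1 a
  cases a <;> simp [execAll, exec, values, -mul_eq_mul_left_iff] <;> ring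

/-- The first part of the program: adds up the numbers `a₁, …, aₘ`. -/
def readSum : Prog (Stack Reg) Γ' :=
  (move .inp .rev).seq <| (copy .rev .inp (.tmp 0)).seq <|
    readNumbers .rev (.reg .t) (add (.reg .s) (.reg .t) (.tmp 0) (.tmp 1))

/-- The second part of the program: writes the fractions `pᵢ` and `cᵢ`, the last ones first. -/
def writeFractions : Prog (Stack Reg) Γ' :=
  (emitAll [.zero, .one, .m6, .zero, .c, .one]).seq <|
    (readNumbers .inp (.reg .cur)
      ((emitAll [.zero, .cur, .m4, .zero, .cur, .one]).seq (clear (.reg .cur)))).seq <|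
    clear (.reg .cur)

/-- The program that computes the reduction. -/
noncomputable def program : Prog (Stack Reg) Γ' :=
  readSum.seq <| (progAll instrs).seq <| writeFractions.seq <|
    (emitAll [.k, .zero, .g, .d]).seq <| clearAll Finset.univ.toList

theorem sum_lt_two_pow_length_encodeNats (l : List ℕ) : l.sum < 2 ^ (encodeNats l).length := by
  induction l with
  | nil => simp
  | cons a l ih =>
    have ha : a < 2 ^ (numeral a).length := by
      rw [numeral_length]
      exact Nat.lt_size_self a
    have length_eq : (encodeNats (a :: l)).length =
        (numeral a).length + (encodeNats l).length + 1 := by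
      rw [← List.singleton_append, encodeNats_append, List.length_append]
      simp only [encodeNats, numeral, List.flatMap_singleton, List.length_append,
        List.length_singleton]
      ring
    rw [length_eq, pow_succ, pow_add, List.sum_cons]
    calc a + l.sum < 2 ^ (numeral a).length + 2 ^ (encodeNats l).length := add_lt_add ha ih
      _ ≤ 2 ^ (numeral a).length * 2 ^ (encodeNats l).length +
          2 ^ (numeral a).length * 2 ^ (encodeNats l).length := by
        gcongr
        · exact Nat.le_mul_of_pos_right _ (by positivity)
        · exact Nat.le_mul_of_pos_left _ (by positivity)
      _ = _ := (mul_two _).symm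

theorem does_readSum (t : ℕ) (l : List ℕ) {B : ℕ} (hB : (encodeNats (t :: l)).length ≤ B) :
    Does readSum (layout (encodeNats (t :: l)) [] [] fun _ => 0)
      (layout (encodeNats (t :: l)).reverse [] [] (update (update (fun _ => 0) .s l.sum) .t t))
      (16 * (B + 1) ^ 2) := by
  let T (q : List ℕ) : Stack Reg → List Γ' :=
    layout (encodeNats (t :: l)).reverse [] [] (update (fun _ => 0) .s q.sum)
  have sum_lt {q : List ℕ} (hq : q <:+ l) : q.sum < 2 ^ B :=
    (hq.sublist.cons t).sum_le_sum (fun _ _ => Nat.zero_le _) |>.trans_lt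
      ((sum_lt_two_pow_length_encodeNats (t :: l)).trans_le (Nat.pow_le_pow_right two_pos hB))
  have add_step (a : ℕ) (q : List ℕ) (w : List Γ') (hq : a :: q <:+ l) :
      Does (Prog.add (.reg .s) (.reg .t) (.tmp 0) (.tmp 1))
        (update (update (T q) .rev w) (.reg .t) (numeral a)) (update (T (a :: q)) .rev w)
        (7 * B + 7) := by
    have hadd : q.sum + a < 2 ^ B := by simpa [add_comm] using sum_lt hq
    simp only [T, update_layout_rev, update_layout_reg]
    refine (does_add_reg (by decide) (by simpa using hadd)).congr ?_ le_rfl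
    congr 1
    grind [update_apply]
  have read := does_readNumbers (by simp) T (fun q => by simp [T, layout]) t l add_step
  simp only [T, update_layout_rev, update_layout_reg, List.sum_nil,
    update_eq_self (Reg.s) (fun _ => 0)] at read
  have reverse : Does (move .inp .rev) (layout (encodeNats (t :: l)) [] [] fun _ : Reg => 0)
      (layout [] (encodeNats (t :: l)).reverse [] fun _ => 0) (2 * B + 1) :=
    (does_move (by simp) _).congr (by simp [layout]) (by simpa [layout] using hB)
  have restore : Does (copy .rev .inp (.tmp 0))
      (layout [] (encodeNats (t :: l)).reverse [] fun _ : Reg => 0)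
      (layout (encodeNats (t :: l)).reverse (encodeNats (t :: l)).reverse [] fun _ => 0)
      (5 * B + 2) :=
    (does_copy (by simp) rfl).congr (by simp [layout]) (by simpa [layout] using hB)
  refine (reverse.seq (restore.seq read)).mono ?_
  nlinarith

theorem does_writeFractions (t : ℕ) (l : List ℕ) {r : Reg → ℕ} {B : ℕ} (hcur : r .cur = 0)
    (hr : ∀ a, r a < 2 ^ B) (hl : ∀ a ∈ t :: l, a < 2 ^ B)
    (hB : (encodeNats (t :: l)).length ≤ B) :
    Does writeFractions (layout (encodeNats (t :: l)).reverse [] [] r)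
      (layout [] [] (encodeNats
        ((l.flatMap fun a => [r .zero, a, r .m4, r .zero, a, r .one]) ++
          [r .zero, r .one, r .m6, r .zero, r .c, r .one])) r) (64 * (B + 1) ^ 2) := by
  let T (q : List ℕ) : Stack Reg → List Γ' := layout [] [] (encodeNats
    ((q.flatMap fun a => [r .zero, a, r .m4, r .zero, a, r .one]) ++
      [r .zero, r .one, r .m6, r .zero, r .c, r .one])) r
  have update_cur : update r .cur 0 = r := hcur ▸ update_eq_self _ _
  have update_lt {a : ℕ} (ha : a < 2 ^ B) (b : Reg) : update r .cur a b < 2 ^ B := by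
    rw [update_apply]
    split_ifs
    exacts [ha, hr b]
  have clear_cur {w v : List Γ'} {a : ℕ} (ha : a < 2 ^ B) :
      Does (clear (.reg .cur)) (layout w [] v (update r .cur a)) (layout w [] v r) (2 * B + 1) := by
    have length_le := numeral_length_le ha
    refine (does_clear _ _).congr (by simp [update_cur]) ?_
    simp only [layout, update_self]
    omega
  have write (a : ℕ) (q : List ℕ) (w : List Γ') (hq : a :: q <:+ l) :
      Does ((emitAll [.zero, .cur, .m4, .zero, .cur, .one]).seq (clear (.reg .cur)))
        (update (update (T q) .inp w) (.reg .cur) (numeral a)) (update (T (a :: q)) .inp w)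
        (6 * (5 * B + 3) + 1 + (2 * B + 1)) := by
    have ha : a < 2 ^ B := hl a (.tail t (hq.subset List.mem_cons_self))
    simp only [T, update_layout_inp, update_layout_reg]
    refine ((does_emitAll _ (update_lt ha)).seq (clear_cur ha)).congr ?_ le_rfl
    rw [← encodeNats_append]
    simp
  have write_last := does_emitAll (i := (encodeNats (t :: l)).reverse) (v := []) (o := [])
    [.zero, .one, .m6, .zero, .c, .one] hr
  have read := does_readNumbers (by simp) T (fun q => by simp [T, layout, hcur]) t l write
  simp only [T, update_layout_inp, update_layout_reg] at read
  refine (write_last.seq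
    (Does.seq (by simpa using read) (clear_cur (hl t List.mem_cons_self)))).mono ?_
  simp only [List.length_cons, List.length_nil]
  nlinarith

theorem does_program (I : NumberPartitioningInstance) {B : ℕ} (hB : I.encode.length ≤ B)
    (hr : ∀ a, values I.t I.sum a < 2 ^ B) :
    Does program (layout I.encode [] [] fun _ => 0) (layout [] [] I.toPareto.encode fun _ => 0)
      (1024 * (B + 1) ^ 2) := by
  have hl (a : ℕ) (ha : a ∈ I.t :: List.ofFn I.a) : a < 2 ^ B :=
    (List.single_le_sum (fun _ _ => Nat.zero_le _) a ha).trans_lt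
      ((sum_lt_two_pow_length_encodeNats _).trans_le (Nat.pow_le_pow_right two_pos hB))
  have read := does_readSum I.t (List.ofFn I.a) hB
  have compute := does_progAll (i := I.encode.reverse) (v := []) (o := []) instrs
    (execAll_instrs I.t I.sum ▸ hr)
  rw [List.sum_ofFn, ← NumberPartitioningInstance.sum] at read
  rw [execAll_instrs] at compute
  refine (read.seq (compute.seq ((does_writeFractions I.t (List.ofFn I.a) rfl hr hl hB).seq
    ((does_emitAll [.k, .zero, .g, .d] hr).seq (does_clearAll Finset.univ.toList hr))))).congr ?_ ?_
  · rw [← encodeNats_append, I.encode_toPareto]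
    simp [values, NumberPartitioningInstance.big]
  · have length_univ : (Finset.univ : Finset Reg).toList.length = 18 := Finset.length_toList _
    have length_instrs : instrs.length = 34 := rfl
    rw [length_univ, length_instrs]
    simp only [List.length_cons, List.length_nil]
    nlinarith

theorem toPareto_computable : Nonempty (Turing.TM2ComputableInPolyTime
    NumberPartitioningInstance.encode BinaryParetoInstance.encode
      NumberPartitioningInstance.toPareto) := by
  refine program.computableInPolyTime .inp .out
    (1024 * (2 ^ instrs.length * (Polynomial.X + 1) + 1) ^ 2) fun I => ?_
  have le_bound : I.encode.length ≤ 2 ^ instrs.length * (I.encode.length + 1) :=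
    (Nat.le_succ _).trans (Nat.le_mul_of_pos_left _ (by positivity))
  have t_add_sum : I.t + I.sum < 2 ^ I.encode.length := by
    have sum_lt := sum_lt_two_pow_length_encodeNats (I.t :: List.ofFn I.a)
    rwa [List.sum_cons, List.sum_ofFn] at sum_lt
  have values_lt (a : Reg) : values I.t I.sum a < 2 ^ (2 ^ instrs.length * (I.encode.length + 1)) :=
    execAll_instrs I.t I.sum ▸ execAll_lt _ (fun b => by grind [update_apply]) a
  have run := does_program I le_bound values_lt
  rw [← update_layout_inp (i := []), ← update_layout_out (o := []) I.toPareto.encode,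
    layout_nil] at run
  simpa using run

end Reduction

end ParetoCover

/-! ### The expected cost under a Bernoulli measure -/

namespace ParetoCover

section Bernoulli

variable {n : ℕ} {p c : Fin n → ℝ} {B : Finset (Cube n)}

/-- The mass that the measure `μ_p` gives to the point `x` of `{0,1}ⁿ`. -/
noncomputable def weight (p : Fin n → ℝ) (x : Fin n → Bool) : ℝ :=
  ∏ i, if x i then p i else 1 - p i

theorem bernoulliMeasure_eq (p : Fin n → ℝ) : bernoulliMeasure p =
    ∑ x : Fin n → Bool, ENNReal.ofReal (weight p x) • Measure.dirac (binaryPoint x) := by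
  simp [bernoulliMeasure, weight, Finset.prod_ite]

theorem weight_nonneg (hp : ∀ i, p i ∈ Set.Icc (0 : ℝ) 1) (x : Fin n → Bool) :
    0 ≤ weight p x := by
  refine Finset.prod_nonneg fun i _ => ?_
  split_ifs
  · exact (hp i).1
  · exact sub_nonneg.2 (hp i).2

theorem sum_weight_mul_prod (p : Fin n → ℝ) (T : Finset (Fin n)) :
    ∑ x, weight p x * ∏ i ∈ T, (binaryPoint x i : ℝ) = ∏ i ∈ T, p i := by
  let factor (i : Fin n) (b : Bool) : ℝ :=
    (if b then p i else 1 - p i) * if i ∈ T then (if b then 1 else 0) else 1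
  have weight_mul_prod (x : Fin n → Bool) :
      weight p x * ∏ i ∈ T, (binaryPoint x i : ℝ) = ∏ i, factor i (x i) := by
    rw [Finset.prod_mul_distrib, Finset.prod_ite_mem, Finset.univ_inter, weight]
    simp only [binaryPoint, apply_ite, Set.Icc.coe_one, Set.Icc.coe_zero]
  have sum_factor (i : Fin n) : ∑ b, factor i b = if i ∈ T then p i else 1 := by
    by_cases hi : i ∈ T <;> simp [factor, hi]
  simp_rw [weight_mul_prod, ← Fintype.piFinset_univ]
  rw [← Finset.prod_univ_sum (fun _ => Finset.univ) factor]
  simp_rw [sum_factor]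
  rw [Finset.prod_ite_mem, Finset.univ_inter]

theorem sum_weight (p : Fin n → ℝ) : ∑ x, weight p x = 1 := by
  simpa using sum_weight_mul_prod p ∅

theorem isProbabilityMeasure_bernoulliMeasure (hp : ∀ i, p i ∈ Set.Icc (0 : ℝ) 1) :
    IsProbabilityMeasure (bernoulliMeasure p) := by
  constructor
  simp only [bernoulliMeasure_eq, Measure.coe_finsetSum, Finset.sum_apply, Measure.smul_apply,
    measure_univ, smul_eq_mul, mul_one]
  rw [← ENNReal.ofReal_sum_of_nonneg fun x _ => weight_nonneg hp x, sum_weight, ENNReal.ofReal_one]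

theorem isParetoCover_iff (hp : ∀ i, p i ∈ Set.Icc (0 : ℝ) 1) :
    IsParetoCover (bernoulliMeasure p) B ↔
      ∀ x, 0 < weight p x → ∃ b ∈ B, binaryPoint x ≤ b := by
  have := isProbabilityMeasure_bernoulliMeasure hp
  have covered_eq : {x : Cube n | ∃ b ∈ B, x ≤ b} = ⋃ b ∈ B, Set.Iic b := by ext; simp
  have measurable_covered : MeasurableSet {x : Cube n | ∃ b ∈ B, x ≤ b} :=
    covered_eq ▸ B.measurableSet_biUnion fun b _ => measurableSet_Iic
  rw [IsParetoCover, ← mem_ae_iff_prob_eq_one measurable_covered, bernoulliMeasure_eq]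
  change (∀ᵐ x ∂_, ∃ b ∈ B, x ≤ b) ↔ _
  simp only [ae_finsetSum_measure_iff, Finset.mem_univ, true_imp_iff]
  refine forall_congr' fun x => ?_
  by_cases hx : 0 < weight p x
  · rw [Measure.ae_ennreal_smul_measure_iff (ENNReal.ofReal_pos.2 hx).ne', ae_dirac_eq]
    simp [hx]
  · simp [ENNReal.ofReal_eq_zero.2 (not_lt.1 hx), hx]

theorem isParetoCover_iff_one_mem (hp : ∀ i, p i ∈ Set.Ioc (0 : ℝ) 1) :
    IsParetoCover (bernoulliMeasure p) B ↔ 1 ∈ B := by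
  rw [isParetoCover_iff fun i => Set.Ioc_subset_Icc_self (hp i)]
  constructor
  · intro h
    obtain ⟨b, hb, hle⟩ := h (fun _ => true) (Finset.prod_pos fun i _ => by simpa using (hp i).1)
    have b_eq_one : b = 1 := funext fun i => unitInterval.le_one'.antisymm (hle i)
    exact b_eq_one ▸ hb
  · exact fun h x _ => ⟨1, h, fun i => unitInterval.le_one'⟩

theorem expectedCost_eq (p c : Fin n → ℝ) (B : Finset (Cube n)) :
    expectedCost (bernoulliMeasure p) c B =
      ∑ x, ENNReal.ofReal (weight p x) * coverCost c B (binaryPoint x) := by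
  simp [expectedCost, bernoulliMeasure_eq, lintegral_smul_measure]

theorem coverCost_le (c : Fin n → ℝ) {x b : Cube n} (hb : b ∈ B) (hx : x ≤ b) :
    coverCost c B x ≤ ENNReal.ofReal (∑ i, c i * (b i : ℝ)) :=
  iInf₂_le_of_le b hb (iInf_le _ hx)

theorem binaryPoint_single_le_iff {i : Fin n} {b : Cube n} :
    binaryPoint (fun j => decide (j = i)) ≤ b ↔ b i = 1 := by
  refine ⟨fun h => unitInterval.le_one'.antisymm (by simpa [binaryPoint] using h i), fun h j => ?_⟩
  obtain rfl | hj := eq_or_ne j i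
  · simp [binaryPoint, h]
  · simp [binaryPoint, hj]

/-- The bound for the cost of covering `x` that is used if the zero vector costs nothing, the unit
vectors of the coordinates in `J` cost at most `C`, and every point costs at most `D`. The sum of
products is at least `1` as soon as `x` has two ones in `J`; it is polynomial in `x`, so that its
expectation can be computed. -/
noncomputable def costBound (J : Finset (Fin n)) (C D : ℝ) (x : Fin n → Bool) : ℝ :=
  C * ∑ i ∈ J, (binaryPoint x i : ℝ) +
    D * (∑ i ∈ Jᶜ, (binaryPoint x i : ℝ) +
      ∑ q ∈ J.offDiag, (binaryPoint x q.1 : ℝ) * (binaryPoint x q.2 : ℝ))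

theorem sum_weight_mul_costBound_le (hp : ∀ i, p i ∈ Set.Icc (0 : ℝ) 1) (J : Finset (Fin n))
    (C : ℝ) {D : ℝ} (hD : 0 ≤ D) :
    ∑ x, weight p x * costBound J C D x ≤
      C * ∑ i ∈ J, p i + D * (∑ i ∈ Jᶜ, p i + (∑ i ∈ J, p i) ^ 2) := by
  have expect_coord (i : Fin n) : ∑ x, weight p x * (binaryPoint x i : ℝ) = p i := by
    simpa using sum_weight_mul_prod p {i}
  have expect_sum (T : Finset (Fin n)) :
      ∑ x, weight p x * ∑ i ∈ T, (binaryPoint x i : ℝ) = ∑ i ∈ T, p i := by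
    simp_rw [Finset.mul_sum]
    rw [Finset.sum_comm]
    simp_rw [expect_coord]
  have expect_pairs : ∑ x, weight p x * ∑ q ∈ J.offDiag,
      (binaryPoint x q.1 : ℝ) * (binaryPoint x q.2 : ℝ) = ∑ q ∈ J.offDiag, p q.1 * p q.2 := by
    simp_rw [Finset.mul_sum]
    rw [Finset.sum_comm]
    refine Finset.sum_congr rfl fun q hq => ?_
    simpa [Finset.prod_pair (Finset.mem_offDiag.1 hq).2.2] using sum_weight_mul_prod p {q.1, q.2}
  have pairs_le : ∑ q ∈ J.offDiag, p q.1 * p q.2 ≤ (∑ i ∈ J, p i) ^ 2 := by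
    rw [sq, Finset.sum_mul_sum, ← Finset.sum_product']
    refine Finset.sum_le_sum_of_subset_of_nonneg (fun q hq => ?_) fun q _ _ =>
      mul_nonneg (hp _).1 (hp _).1
    exact Finset.mem_product.2 ⟨(Finset.mem_offDiag.1 hq).1, (Finset.mem_offDiag.1 hq).2.1⟩
  simp_rw [costBound, mul_add, mul_left_comm (weight p _), Finset.sum_add_distrib,
    ← Finset.mul_sum, expect_sum, expect_pairs]
  gcongr

theorem sum_binaryPoint_nonneg (T : Finset (Fin n)) (x : Fin n → Bool) :
    0 ≤ ∑ i ∈ T, (binaryPoint x i : ℝ) :=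
  Finset.sum_nonneg fun _ _ => unitInterval.nonneg _

theorem sum_binaryPoint_mul_nonneg (T : Finset (Fin n × Fin n)) (x : Fin n → Bool) :
    0 ≤ ∑ q ∈ T, (binaryPoint x q.1 : ℝ) * (binaryPoint x q.2 : ℝ) :=
  Finset.sum_nonneg fun _ _ => mul_nonneg (unitInterval.nonneg _) (unitInterval.nonneg _)

theorem one_le_sum_binaryPoint {T : Finset (Fin n)} {x : Fin n → Bool} {i : Fin n} (hi : i ∈ T)
    (hx : x i = true) : 1 ≤ ∑ i ∈ T, (binaryPoint x i : ℝ) := by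
  have coord_eq : (binaryPoint x i : ℝ) = 1 := by simp [binaryPoint, hx]
  exact coord_eq ▸ Finset.single_le_sum (f := fun i => (binaryPoint x i : ℝ))
    (fun _ _ => unitInterval.nonneg _) hi

theorem one_le_sum_binaryPoint_mul {T : Finset (Fin n × Fin n)} {x : Fin n → Bool} {i j : Fin n}
    (hij : (i, j) ∈ T) (hi : x i = true) (hj : x j = true) :
    1 ≤ ∑ q ∈ T, (binaryPoint x q.1 : ℝ) * (binaryPoint x q.2 : ℝ) := by
  have product_eq : (binaryPoint x i : ℝ) * (binaryPoint x j : ℝ) = 1 := by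
    simp [binaryPoint, hi, hj]
  exact product_eq ▸ Finset.single_le_sum
    (f := fun q : Fin n × Fin n => (binaryPoint x q.1 : ℝ) * (binaryPoint x q.2 : ℝ))
    (fun _ _ => mul_nonneg (unitInterval.nonneg _) (unitInterval.nonneg _)) hij

theorem costBound_nonneg {J : Finset (Fin n)} {C D : ℝ} (hC : 0 ≤ C) (hD : 0 ≤ D)
    (x : Fin n → Bool) : 0 ≤ costBound J C D x :=
  add_nonneg (mul_nonneg hC (sum_binaryPoint_nonneg J x))
    (mul_nonneg hD (add_nonneg (sum_binaryPoint_nonneg Jᶜ x) (sum_binaryPoint_mul_nonneg _ x)))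

theorem le_costBound {J : Finset (Fin n)} {C D : ℝ} (hC : 0 ≤ C) (hD : 0 ≤ D)
    {x : Fin n → Bool} {i : Fin n} (hi : i ∈ J) (hx : x i = true) : C ≤ costBound J C D x := by
  have h₁ := one_le_sum_binaryPoint hi hx
  have h₂ := sum_binaryPoint_nonneg Jᶜ x
  have h₃ := sum_binaryPoint_mul_nonneg J.offDiag x
  exact (le_mul_of_one_le_right hC h₁).trans
    (le_add_of_nonneg_right (mul_nonneg hD (add_nonneg h₂ h₃)))

theorem le_costBound_of_notMem {J : Finset (Fin n)} {C D : ℝ} (hC : 0 ≤ C) (hD : 0 ≤ D)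
    {x : Fin n → Bool} {i : Fin n} (hi : i ∉ J) (hx : x i = true) : D ≤ costBound J C D x := by
  have h₁ := sum_binaryPoint_nonneg J x
  have h₂ := one_le_sum_binaryPoint (Finset.mem_compl.2 hi) hx
  have h₃ := sum_binaryPoint_mul_nonneg J.offDiag x
  exact (le_mul_of_one_le_right hD (le_add_of_le_of_nonneg h₂ h₃)).trans
    (le_add_of_nonneg_left (mul_nonneg hC h₁))

theorem le_costBound_of_ne {J : Finset (Fin n)} {C D : ℝ} (hC : 0 ≤ C) (hD : 0 ≤ D)
    {x : Fin n → Bool} {i j : Fin n} (hi : i ∈ J) (hj : j ∈ J) (hij : i ≠ j) (hxi : x i = true)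
    (hxj : x j = true) : D ≤ costBound J C D x := by
  have h₁ := sum_binaryPoint_nonneg J x
  have h₂ := sum_binaryPoint_nonneg Jᶜ x
  have h₃ := one_le_sum_binaryPoint_mul (Finset.mem_offDiag.2 ⟨hi, hj, hij⟩) hxi hxj
  exact (le_mul_of_one_le_right hD (le_add_of_nonneg_of_le h₂ h₃)).trans
    (le_add_of_nonneg_left (mul_nonneg hC h₁))

theorem coverCost_le_costBound {J : Finset (Fin n)} {C D : ℝ} (hC : 0 ≤ C) (hD : 0 ≤ D)
    (zero_mem : 0 ∈ B) (one_mem : 1 ∈ B) (hc : ∑ i, c i ≤ D)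
    (hJ : ∀ i ∈ J, ∃ b ∈ B, b i = 1 ∧ ∑ k, c k * (b k : ℝ) ≤ C) (x : Fin n → Bool) :
    coverCost c B (binaryPoint x) ≤ ENNReal.ofReal (costBound J C D x) := by
  have le_of_one (h : D ≤ costBound J C D x) :
      coverCost c B (binaryPoint x) ≤ ENNReal.ofReal (costBound J C D x) :=
    (coverCost_le c one_mem fun _ => unitInterval.le_one').trans
      (ENNReal.ofReal_le_ofReal (by simpa using hc.trans h))
  by_cases outside : ∃ i ∉ J, x i = true
  · obtain ⟨i, hi, hx⟩ := outside
    exact le_of_one (le_costBound_of_notMem hC hD hi hx)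
  by_cases nonzero : ∃ i, x i = true
  · obtain ⟨i, hx⟩ := nonzero
    have hi : i ∈ J := by_contra fun hi => outside ⟨i, hi, hx⟩
    by_cases pair : ∃ j ∈ J, i ≠ j ∧ x j = true
    · obtain ⟨j, hj, hij, hxj⟩ := pair
      exact le_of_one (le_costBound_of_ne hC hD hi hj hij hx hxj)
    · have x_eq : x = fun j => decide (j = i) := by
        grind
      obtain ⟨b, hb, hbi, cost_le⟩ := hJ i hi
      refine (coverCost_le c hb ?_).trans
        (ENNReal.ofReal_le_ofReal (cost_le.trans (le_costBound hC hD hi hx)))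
      rw [x_eq]
      exact binaryPoint_single_le_iff.2 hbi
  · have x_eq : x = fun _ => false := by grind
    refine (coverCost_le c zero_mem ?_).trans
      (ENNReal.ofReal_le_ofReal (by simpa using costBound_nonneg hC hD x))
    simp [x_eq, binaryPoint, Pi.le_def]

theorem expectedCost_le (hp : ∀ i, p i ∈ Set.Icc (0 : ℝ) 1) {J : Finset (Fin n)} {C D : ℝ}
    (hC : 0 ≤ C) (hD : 0 ≤ D) (zero_mem : 0 ∈ B) (one_mem : 1 ∈ B) (hc : ∑ i, c i ≤ D)
    (hJ : ∀ i ∈ J, ∃ b ∈ B, b i = 1 ∧ ∑ k, c k * (b k : ℝ) ≤ C) :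
    expectedCost (bernoulliMeasure p) c B ≤
      ENNReal.ofReal (C * ∑ i ∈ J, p i + D * (∑ i ∈ Jᶜ, p i + (∑ i ∈ J, p i) ^ 2)) := by
  calc expectedCost (bernoulliMeasure p) c B
      = ∑ x, ENNReal.ofReal (weight p x) * coverCost c B (binaryPoint x) := expectedCost_eq p c B
    _ ≤ ∑ x, ENNReal.ofReal (weight p x) * ENNReal.ofReal (costBound J C D x) := by
        gcongr
        exact coverCost_le_costBound hC hD zero_mem one_mem hc hJ _
    _ = ENNReal.ofReal (∑ x, weight p x * costBound J C D x) := by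
        rw [ENNReal.ofReal_sum_of_nonneg fun x _ =>
          mul_nonneg (weight_nonneg hp x) (costBound_nonneg hC hD x)]
        simp_rw [ENNReal.ofReal_mul (weight_nonneg hp _)]
    _ ≤ _ := ENNReal.ofReal_le_ofReal (sum_weight_mul_costBound_le hp J C hD)

/-- The cost of the coordinates of `b` that are equal to `1`, that is, of the largest point of
`{0,1}ⁿ` covered by `b`. -/
noncomputable def floorCost (c : Fin n → ℝ) (b : Cube n) : ℝ := ∑ i with b i = 1, c i

theorem floorCost_le (hc : ∀ i, 0 ≤ c i) (b : Cube n) :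
    floorCost c b ≤ ∑ i, c i * (b i : ℝ) := by
  rw [floorCost, Finset.sum_filter]
  gcongr with i
  split_ifs with h
  · simp [h]
  · exact mul_nonneg (hc i) (unitInterval.nonneg _)

theorem sum_le_floorCost (hc : ∀ i, 0 ≤ c i) {b : Cube n} {T : Finset (Fin n)}
    (hT : ∀ i ∈ T, b i = 1) : ∑ i ∈ T, c i ≤ floorCost c b :=
  Finset.sum_le_sum_of_subset_of_nonneg (fun i hi => by simpa using hT i hi) fun i _ _ => hc i

theorem le_floorCost (hc : ∀ i, 0 ≤ c i) {b : Cube n} {i : Fin n} (hi : b i = 1) :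
    c i ≤ floorCost c b := by
  simpa using sum_le_floorCost hc (T := {i}) (by simpa using hi)

theorem le_coverCost (hc : ∀ i, 0 ≤ c i) {x : Cube n} {r : ℝ}
    (h : ∀ b ∈ B, x ≤ b → r ≤ floorCost c b) : ENNReal.ofReal r ≤ coverCost c B x :=
  le_iInf₂ fun b hb => le_iInf fun hx =>
    ENNReal.ofReal_le_ofReal ((h b hb hx).trans (floorCost_le hc b))

theorem one_sub_sum_le_prod (hp : ∀ i, p i ∈ Set.Icc (0 : ℝ) 1) (T : Finset (Fin n)) :
    1 - ∑ i ∈ T, p i ≤ ∏ i ∈ T, (1 - p i) := by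
  induction T using Finset.induction_on with
  | empty => simp
  | insert i T hi ih =>
    rw [Finset.sum_insert hi, Finset.prod_insert hi]
    have sum_nonneg : 0 ≤ ∑ j ∈ T, p j := Finset.sum_nonneg fun j _ => (hp j).1
    calc 1 - (p i + ∑ j ∈ T, p j) ≤ (1 - p i) * (1 - ∑ j ∈ T, p j) := by
          linarith [mul_nonneg (hp i).1 sum_nonneg]
      _ ≤ (1 - p i) * ∏ j ∈ T, (1 - p j) :=
          mul_le_mul_of_nonneg_left ih (sub_nonneg.2 (hp i).2)

theorem one_sub_sum_le_weight_zero (hp : ∀ i, p i ∈ Set.Icc (0 : ℝ) 1) :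
    1 - ∑ i, p i ≤ weight p fun _ => false := by
  simpa [weight] using one_sub_sum_le_prod hp Finset.univ

theorem mul_one_sub_sum_le_weight_single (hp : ∀ i, p i ∈ Set.Icc (0 : ℝ) 1) (i : Fin n) :
    p i * (1 - ∑ j, p j) ≤ weight p fun j => decide (j = i) := by
  have weight_eq : (weight p fun j => decide (j = i)) =
      p i * ∏ j ∈ Finset.univ.erase i, (1 - p j) := by
    rw [weight, ← Finset.mul_prod_erase _ _ (Finset.mem_univ i)]
    congr 1
    · simp
    · exact Finset.prod_congr rfl fun j hj => by simp [Finset.ne_of_mem_erase hj]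
  have sum_erase_le : ∑ j ∈ Finset.univ.erase i, p j ≤ ∑ j, p j :=
    Finset.sum_le_sum_of_subset_of_nonneg (Finset.erase_subset _ _) fun j _ _ => (hp j).1
  rw [weight_eq]
  exact mul_le_mul_of_nonneg_left ((sub_le_sub_left sum_erase_le 1).trans
    (one_sub_sum_le_prod hp _)) (hp i).1

theorem le_expectedCost (hp : ∀ i, p i ∈ Set.Icc (0 : ℝ) 1) {ι : Type*} {J : Finset ι}
    {x : ι → Fin n → Bool} (hx : Set.InjOn x J) {r : ι → ℝ} (hr : ∀ i ∈ J, 0 ≤ r i)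
    (h : ∀ i ∈ J, ENNReal.ofReal (r i) ≤ coverCost c B (binaryPoint (x i))) :
    ENNReal.ofReal (∑ i ∈ J, weight p (x i) * r i) ≤ expectedCost (bernoulliMeasure p) c B := by
  classical
  calc ENNReal.ofReal (∑ i ∈ J, weight p (x i) * r i)
      = ∑ i ∈ J, ENNReal.ofReal (weight p (x i)) * ENNReal.ofReal (r i) := by
        rw [ENNReal.ofReal_sum_of_nonneg fun i hi => mul_nonneg (weight_nonneg hp _) (hr i hi)]
        simp_rw [ENNReal.ofReal_mul (weight_nonneg hp _)]
    _ ≤ ∑ i ∈ J, ENNReal.ofReal (weight p (x i)) * coverCost c B (binaryPoint (x i)) := by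
        gcongr with i hi
        exact h i hi
    _ = ∑ y ∈ J.image x, ENNReal.ofReal (weight p y) * coverCost c B (binaryPoint y) := by
        rw [Finset.sum_image hx]
    _ ≤ ∑ y, ENNReal.ofReal (weight p y) * coverCost c B (binaryPoint y) :=
        Finset.sum_le_sum_of_subset (Finset.subset_univ _)
    _ = expectedCost (bernoulliMeasure p) c B := (expectedCost_eq p c B).symm

theorem one_sub_sum_mul_le_expectedCost (hp : ∀ i, p i ∈ Set.Icc (0 : ℝ) 1) (hc : ∀ i, 0 ≤ c i)
    {r : ℝ} (hr : 0 ≤ r) (h : ∀ b ∈ B, r ≤ floorCost c b) :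
    ENNReal.ofReal ((1 - ∑ i, p i) * r) ≤ expectedCost (bernoulliMeasure p) c B := by
  have cost_zero_ge := le_expectedCost hp (J := {fun _ : Fin n => false}) (x := id)
    (r := fun _ => r) Function.injective_id.injOn (fun _ _ => hr)
    fun _ _ => le_coverCost hc fun b hb _ => h b hb
  rw [Finset.sum_singleton, id] at cost_zero_ge
  refine le_trans (ENNReal.ofReal_le_ofReal ?_) cost_zero_ge
  exact mul_le_mul_of_nonneg_right (one_sub_sum_le_weight_zero hp) hr

theorem one_sub_sum_mul_sum_le_expectedCost (hp : ∀ i, p i ∈ Set.Icc (0 : ℝ) 1)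
    (hc : ∀ i, 0 ≤ c i) {J : Finset (Fin n)} {r : Fin n → ℝ} (hr : ∀ i ∈ J, 0 ≤ r i)
    (h : ∀ i ∈ J, ∀ b ∈ B, b i = 1 → r i ≤ floorCost c b) :
    ENNReal.ofReal ((1 - ∑ i, p i) * ∑ i ∈ J, p i * r i) ≤
      expectedCost (bernoulliMeasure p) c B := by
  have single_injective : Function.Injective fun i j : Fin n => decide (j = i) := fun i k hik => by
    simpa using congrFun hik i
  refine le_trans (ENNReal.ofReal_le_ofReal ?_) (le_expectedCost hp single_injective.injOn hr
    fun i hi => le_coverCost hc fun b hb hx => h i hi b hb (binaryPoint_single_le_iff.1 hx))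
  rw [Finset.mul_sum]
  refine Finset.sum_le_sum fun i hi => ?_
  rw [← mul_assoc, mul_comm _ (p i)]
  exact mul_le_mul_of_nonneg_right (mul_one_sub_sum_le_weight_single hp i) (hr i hi)

end Bernoulli

end ParetoCover

/-! ### Correctness of the reduction -/

namespace ParetoCover

theorem eq_of_sum_sq_le {ι R : Type*} [Fintype ι] [CommRing R] [LinearOrder R]
    [IsStrictOrderedRing R] {s : ι → R} {q : R} (sum_eq : ∑ j, s j = Fintype.card ι * q)
    (sum_sq_le : ∑ j, s j ^ 2 ≤ Fintype.card ι * q ^ 2) (j : ι) : s j = q := by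
  have variance_eq : ∑ j, (s j - q) ^ 2 = ∑ j, s j ^ 2 - Fintype.card ι * q ^ 2 := by
    simp only [sub_sq, Finset.sum_add_distrib, Finset.sum_sub_distrib, ← Finset.sum_mul,
      ← Finset.mul_sum, sum_eq, Finset.sum_const, Finset.card_univ, nsmul_eq_mul]
    ring
  have variance_zero : ∑ j, (s j - q) ^ 2 = 0 :=
    le_antisymm (variance_eq ▸ sub_nonpos.2 sum_sq_le) (Finset.sum_nonneg fun _ _ => sq_nonneg _)
  have sq_zero := (Finset.sum_eq_zero_iff_of_nonneg fun _ _ => sq_nonneg _).1 variance_zero j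
    (Finset.mem_univ j)
  exact sub_eq_zero.1 (pow_eq_zero_iff two_ne_zero |>.1 sq_zero)

theorem sum_mul_sum_fiber {ι κ R : Type*} [Fintype ι] [Fintype κ] [DecidableEq κ] [CommSemiring R]
    (a : ι → R) (φ : ι → κ) :
    ∑ i, a i * ∑ k with φ k = φ i, a k = ∑ j, (∑ i with φ i = j, a i) ^ 2 := by
  rw [← Finset.sum_fiberwise _ φ]
  refine Finset.sum_congr rfl fun j _ => ?_
  rw [sq, Finset.sum_mul]
  refine Finset.sum_congr rfl fun i hi => ?_
  rw [(Finset.mem_filter.1 hi).2]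

section PartitionCover

variable {m t : ℕ}

/-- The incidence vector of the `j`-th block of the partition given by `φ`, extended by a last
coordinate `0`. -/
noncomputable def blockPoint (φ : Fin m → Fin t) (j : Fin t) : Cube (m + 1) :=
  Fin.snoc (α := fun _ => unitInterval) (fun i => if φ i = j then 1 else 0) 0

theorem blockPoint_castSucc (φ : Fin m → Fin t) (j : Fin t) (i : Fin m) :
    blockPoint φ j i.castSucc = if φ i = j then 1 else 0 :=
  Fin.snoc_castSucc ..

theorem blockPoint_last (φ : Fin m → Fin t) (j : Fin t) : blockPoint φ j (Fin.last m) = 0 :=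
  Fin.snoc_last ..

theorem sum_mul_blockPoint (c : Fin (m + 1) → ℝ) (φ : Fin m → Fin t) (j : Fin t) :
    ∑ i, c i * (blockPoint φ j i : ℝ) = ∑ i with φ i = j, c i.castSucc := by
  simp [Fin.sum_univ_castSucc, blockPoint_castSucc, blockPoint_last, apply_ite, Finset.sum_filter]

/-- The cover that belongs to a partition: `0` covers the zero vector for free, the blocks cover
the unit vectors other than the last one cheaply, and `1` covers all remaining points. -/
noncomputable def partitionCover (φ : Fin m → Fin t) : Finset (Cube (m + 1)) :=
  insert 1 (insert 0 (Finset.univ.image (blockPoint φ)))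

theorem card_partitionCover {φ : Fin m → Fin t} (hφ : Function.Surjective φ) :
    (partitionCover φ).card = t + 2 := by
  have blockPoint_injective : Function.Injective (blockPoint φ) := fun j l hjl => by
    obtain ⟨i, rfl⟩ := hφ j
    simpa [blockPoint_castSucc, eq_comm] using congrFun hjl i.castSucc
  have zero_notMem : (0 : Cube (m + 1)) ∉ Finset.univ.image (blockPoint φ) := fun h => by
    obtain ⟨j, -, hj⟩ := Finset.mem_image.1 h
    obtain ⟨i, rfl⟩ := hφ j
    simpa [blockPoint_castSucc] using congrFun hj i.castSucc
  have one_notMem : (1 : Cube (m + 1)) ∉ insert 0 (Finset.univ.image (blockPoint φ)) := fun h => by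
    rcases Finset.mem_insert.1 h with h | h
    · simpa using congrFun h 0
    · obtain ⟨j, -, hj⟩ := Finset.mem_image.1 h
      simpa [blockPoint_last] using congrFun hj (Fin.last m)
  rw [partitionCover, Finset.card_insert_of_notMem one_notMem,
    Finset.card_insert_of_notMem zero_notMem,
    Finset.card_image_of_injective _ blockPoint_injective, Finset.card_fin]

end PartitionCover

namespace NumberPartitioningInstance

variable (I : NumberPartitioningInstance)

theorem toPareto_p_castSucc (i : Fin I.m) :
    (I.toPareto.p (i.castSucc : Fin (I.m + 1))).val = (I.a i : ℚ) / (I.big : ℚ) ^ 4 := by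
  simp [toPareto, Fraction.val]

theorem toPareto_p_last :
    (I.toPareto.p (Fin.last I.m : Fin (I.m + 1))).val = 1 / (I.big : ℚ) ^ 6 := by
  simp [toPareto, Fraction.val]

theorem toPareto_c_castSucc (i : Fin I.m) :
    (I.toPareto.c (i.castSucc : Fin (I.m + 1))).val = (I.a i : ℚ) := by
  simp [toPareto, Fraction.val]

theorem toPareto_c_last :
    (I.toPareto.c (Fin.last I.m : Fin (I.m + 1))).val = 2 * (I.big : ℚ) := by
  simp [toPareto, Fraction.val]

theorem toPareto_gamma : I.toPareto.γ.val =
    1 / (I.big : ℚ) ^ 4 * ((I.sum : ℚ) ^ 2 / (I.t : ℚ)) + 6 / (I.big : ℚ) ^ 5 := by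
  have big_ne_zero : (I.big : ℚ) ≠ 0 := Nat.cast_ne_zero.2 I.big_pos.ne'
  have t_ne_zero : (I.t : ℚ) ≠ 0 := Nat.cast_ne_zero.2 I.t_pos.ne'
  simp only [toPareto, Fraction.val]
  push_cast
  field_simp

/-- The vector `p` of the instance `I.toPareto`, with real entries. -/
noncomputable def prob (i : Fin (I.m + 1)) : ℝ := ((I.toPareto.p i).val : ℝ)

/-- The vector `c` of the instance `I.toPareto`, with real entries. -/
noncomputable def cost (i : Fin (I.m + 1)) : ℝ := ((I.toPareto.c i).val : ℝ)

/-- The bound `γ` of the instance `I.toPareto`, as a real number. -/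
noncomputable def bound : ℝ := (I.toPareto.γ.val : ℝ)

theorem prob_castSucc (i : Fin I.m) : I.prob i.castSucc = (I.a i : ℝ) / (I.big : ℝ) ^ 4 := by
  simp [prob, toPareto_p_castSucc]

theorem prob_last : I.prob (Fin.last I.m) = 1 / (I.big : ℝ) ^ 6 := by
  simp [prob, toPareto_p_last]

theorem cost_castSucc (i : Fin I.m) : I.cost i.castSucc = (I.a i : ℝ) := by
  simp [cost, toPareto_c_castSucc]

theorem cost_last : I.cost (Fin.last I.m) = 2 * (I.big : ℝ) := by
  simp [cost, toPareto_c_last]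

theorem bound_eq : I.bound =
    1 / (I.big : ℝ) ^ 4 * ((I.sum : ℝ) ^ 2 / (I.t : ℝ)) + 6 / (I.big : ℝ) ^ 5 := by
  simp [bound, toPareto_gamma]

theorem bound_nonneg : 0 ≤ I.bound := by
  rw [bound_eq]
  positivity

theorem big_eq : (I.big : ℝ) = 13 * (I.sum : ℝ) ^ 2 := by simp [big]

theorem one_le_sum : (1 : ℝ) ≤ I.sum := Nat.one_le_cast.2 I.sum_pos

theorem one_le_t : (1 : ℝ) ≤ I.t := Nat.one_le_cast.2 I.t_pos

theorem one_le_a (i : Fin I.m) : (1 : ℝ) ≤ I.a i := Nat.one_le_cast.2 (I.a_pos i)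

theorem thirteen_mul_sum_le_big : 13 * (I.sum : ℝ) ≤ I.big := by
  rw [big_eq]
  gcongr
  exact le_self_pow₀ I.one_le_sum two_ne_zero

theorem thirteen_le_big : (13 : ℝ) ≤ I.big := by
  linarith [I.one_le_sum, I.thirteen_mul_sum_le_big]

theorem sum_a : ∑ i, (I.a i : ℝ) = I.sum := by simp [sum]

theorem sum_prob : ∑ i, I.prob i = I.sum / (I.big : ℝ) ^ 4 + 1 / (I.big : ℝ) ^ 6 := by
  simp_rw [Fin.sum_univ_castSucc, prob_castSucc, prob_last, ← Finset.sum_div, sum_a]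

theorem sum_prob_compl_last :
    ∑ i ∈ {Fin.last I.m}ᶜ, I.prob i = I.sum / (I.big : ℝ) ^ 4 := by
  have sum_split := Finset.sum_compl_add_sum {Fin.last I.m} I.prob
  rw [Finset.sum_singleton, prob_last, sum_prob] at sum_split
  exact add_right_cancel sum_split

theorem sum_cost : ∑ i, I.cost i = I.sum + 2 * I.big := by
  simp_rw [Fin.sum_univ_castSucc, cost_castSucc, cost_last, sum_a]

theorem prob_mem_Icc (i : Fin (I.m + 1)) : I.prob i ∈ Set.Icc (0 : ℝ) 1 := by
  have h := I.toPareto.p_mem i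
  rw [Set.mem_Icc, prob]
  exact_mod_cast h

theorem prob_mem_Ioc (i : Fin (I.m + 1)) : I.prob i ∈ Set.Ioc (0 : ℝ) 1 := by
  refine ⟨?_, (I.prob_mem_Icc i).2⟩
  have big_pos : (0 : ℝ) < I.big := Nat.cast_pos.2 I.big_pos
  refine Fin.lastCases ?_ (fun i => ?_) i
  · rw [prob_last]
    positivity
  · rw [prob_castSucc]
    exact div_pos (Nat.cast_pos.2 (I.a_pos i)) (pow_pos big_pos 4)

theorem one_le_cost (i : Fin (I.m + 1)) : 1 ≤ I.cost i := by
  refine Fin.lastCases ?_ (fun i => ?_) i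
  · rw [cost_last]
    linarith [I.thirteen_le_big]
  · rw [cost_castSucc]
    exact I.one_le_a i

theorem cost_nonneg (i : Fin (I.m + 1)) : 0 ≤ I.cost i :=
  zero_le_one.trans (I.one_le_cost i)

theorem isYes_toPareto_iff : I.toPareto.IsYes ↔ ∃ B : Finset (Cube (I.m + 1)),
    1 ∈ B ∧ B.card = I.t + 2 ∧
      expectedCost (bernoulliMeasure I.prob) I.cost B ≤ ENNReal.ofReal I.bound := by
  refine exists_congr fun B => ?_
  refine and_congr (isParetoCover_iff_one_mem I.prob_mem_Ioc) (and_congr Iff.rfl ?_)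
  rw [← EReal.coe_ennreal_le_coe_ennreal_iff, EReal.coe_ennreal_ofReal,
    max_eq_left I.bound_nonneg]
  rfl

theorem isYes_iff_exists_assignment :
    I.IsYes ↔ ∃ φ : Fin I.m → Fin I.t, ∀ j, I.t * ∑ i with φ i = j, I.a i = I.sum := by
  have t_ne_zero : (I.t : ℚ) ≠ 0 := Nat.cast_ne_zero.2 I.t_pos.ne'
  have block_iff (T : Finset (Fin I.m)) : I.t * ∑ i ∈ T, I.a i = I.sum ↔
      ∑ i ∈ T, (I.a i : ℚ) = 1 / (I.t : ℚ) * ∑ i, (I.a i : ℚ) := by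
    rw [one_div, eq_inv_mul_iff_mul_eq₀ t_ne_zero, sum]
    norm_cast
  simp only [block_iff]
  constructor
  · rintro ⟨P, disjoint, cover, block_sum⟩
    choose φ hφ using cover
    have block_eq (j : Fin I.t) : Finset.univ.filter (φ · = j) = P j := by
      ext i
      simp only [Finset.mem_filter, Finset.mem_univ, true_and]
      refine ⟨fun h => h ▸ hφ i, fun hi => by_contra fun hne => ?_⟩
      exact Finset.disjoint_left.1 (disjoint hne) (hφ i) hi
    exact ⟨φ, fun j => block_eq j ▸ block_sum j⟩
  · rintro ⟨φ, block_sum⟩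
    refine ⟨fun j => Finset.univ.filter (φ · = j), fun j l hjl => ?_, fun i => ⟨φ i, by simp⟩,
      block_sum⟩
    exact Finset.disjoint_filter.2 fun i _ hj hl => hjl (hj.symm.trans hl)

theorem surjective_of_block_sum {φ : Fin I.m → Fin I.t}
    (hφ : ∀ j, I.t * ∑ i with φ i = j, I.a i = I.sum) : Function.Surjective φ := by
  intro j
  have block_ne_zero : ∑ i with φ i = j, I.a i ≠ 0 := fun h => by
    simpa [h, I.sum_pos.ne] using hφ j
  obtain ⟨i, hi, -⟩ := Finset.exists_ne_zero_of_sum_ne_zero block_ne_zero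
  exact ⟨i, (Finset.mem_filter.1 hi).2⟩

theorem upperBound_le_bound :
    (I.sum : ℝ) / I.t * (I.sum / (I.big : ℝ) ^ 4) +
      3 * I.big * (1 / (I.big : ℝ) ^ 6 + (I.sum / (I.big : ℝ) ^ 4) ^ 2) ≤ I.bound := by
  have big_pos : (0 : ℝ) < I.big := Nat.cast_pos.2 I.big_pos
  have sum_sq_le : (I.sum : ℝ) ^ 2 ≤ (I.big : ℝ) ^ 2 := by
    gcongr
    exact I.sum_le_big
  calc (I.sum : ℝ) / I.t * (I.sum / (I.big : ℝ) ^ 4) +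
        3 * I.big * (1 / (I.big : ℝ) ^ 6 + (I.sum / (I.big : ℝ) ^ 4) ^ 2)
      = 1 / (I.big : ℝ) ^ 4 * ((I.sum : ℝ) ^ 2 / I.t) + 3 / (I.big : ℝ) ^ 5 +
          3 * (I.sum : ℝ) ^ 2 / (I.big : ℝ) ^ 7 := by field_simp; ring
    _ ≤ 1 / (I.big : ℝ) ^ 4 * ((I.sum : ℝ) ^ 2 / I.t) + 3 / (I.big : ℝ) ^ 5 +
          3 * (I.big : ℝ) ^ 2 / (I.big : ℝ) ^ 7 := by gcongr
    _ = I.bound := by rw [bound_eq]; field_simp; ring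

theorem expectedCost_partitionCover_le {φ : Fin I.m → Fin I.t}
    (hφ : ∀ j, I.t * ∑ i with φ i = j, I.a i = I.sum) :
    expectedCost (bernoulliMeasure I.prob) I.cost (partitionCover φ) ≤
      ENNReal.ofReal I.bound := by
  have t_ne_zero : (I.t : ℝ) ≠ 0 := Nat.cast_ne_zero.2 I.t_pos.ne'
  have cost_blockPoint (j : Fin I.t) :
      ∑ i, I.cost i * (blockPoint φ j i : ℝ) = I.sum / I.t := by
    simp_rw [sum_mul_blockPoint, cost_castSucc]
    rw [eq_div_iff t_ne_zero, mul_comm]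
    exact_mod_cast hφ j
  have sum_cost_le : ∑ i, I.cost i ≤ 3 * I.big := by
    linarith [I.sum_cost, (Nat.cast_le (α := ℝ)).2 I.sum_le_big]
  have unit_cost_le (i : Fin (I.m + 1)) (hi : i ∈ ({Fin.last I.m}ᶜ : Finset _)) :
      ∃ b ∈ partitionCover φ, b i = 1 ∧ ∑ k, I.cost k * (b k : ℝ) ≤ I.sum / I.t := by
    obtain ⟨k, rfl⟩ := Fin.exists_castSucc_eq.2 (by simpa using hi)
    exact ⟨blockPoint φ (φ k), by simp [partitionCover], by simp [blockPoint_castSucc],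
      (cost_blockPoint _).le⟩
  refine (expectedCost_le I.prob_mem_Icc (by positivity) (by positivity)
    (by simp [partitionCover]) (by simp [partitionCover]) sum_cost_le unit_cost_le).trans
    (ENNReal.ofReal_le_ofReal ?_)
  rw [sum_prob_compl_last, compl_compl, Finset.sum_singleton, prob_last]
  exact I.upperBound_le_bound

theorem isYes_toPareto (h : I.IsYes) : I.toPareto.IsYes := by
  obtain ⟨φ, hφ⟩ := I.isYes_iff_exists_assignment.1 h
  exact I.isYes_toPareto_iff.2 ⟨partitionCover φ, by simp [partitionCover],
    card_partitionCover (I.surjective_of_block_sum hφ), I.expectedCost_partitionCover_le hφ⟩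

theorem sum_prob_le : ∑ i, I.prob i ≤ 1 / (I.big : ℝ) ^ 3 := by
  have big_ge := I.thirteen_le_big
  have sum_le : (I.sum : ℝ) ≤ I.big / 13 := by linarith [I.thirteen_mul_sum_le_big]
  have cube_le : 1 / (I.big : ℝ) ^ 3 ≤ 1 / 13 := one_div_le_one_div_of_le (by norm_num)
    (big_ge.trans (le_self_pow₀ (by linarith) (by norm_num)))
  calc ∑ i, I.prob i = I.sum / (I.big : ℝ) ^ 4 + 1 / (I.big : ℝ) ^ 6 := I.sum_prob
    _ ≤ (I.big / 13) / (I.big : ℝ) ^ 4 + 1 / (I.big : ℝ) ^ 6 := by gcongr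
    _ = 1 / (I.big : ℝ) ^ 3 * (1 / 13 + 1 / (I.big : ℝ) ^ 3) := by field_simp
    _ ≤ 1 / (I.big : ℝ) ^ 3 * 1 := by gcongr; linarith
    _ = 1 / (I.big : ℝ) ^ 3 := mul_one _

theorem one_div_big_cube_le_half : 1 / (I.big : ℝ) ^ 3 ≤ 1 / 2 := by
  have big_ge := I.thirteen_le_big
  exact one_div_le_one_div_of_le two_pos
    ((by linarith : (2 : ℝ) ≤ I.big).trans (le_self_pow₀ (by linarith) (by norm_num)))

theorem half_le_one_sub_sum_prob : 1 / 2 ≤ 1 - ∑ i, I.prob i := by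
  linarith [I.sum_prob_le, I.one_div_big_cube_le_half]

theorem sum_sq_div_le : (I.sum : ℝ) ^ 2 / I.t ≤ I.big / 13 := by
  rw [big_eq]
  linarith [div_le_self (sq_nonneg (I.sum : ℝ)) I.one_le_t]

theorem bound_eq_mul :
    I.bound = 1 / (I.big : ℝ) ^ 4 * ((I.sum : ℝ) ^ 2 / I.t + 6 / I.big) := by
  have big_ne_zero : (I.big : ℝ) ≠ 0 := Nat.cast_ne_zero.2 I.big_pos.ne'
  rw [bound_eq]
  field_simp

theorem six_div_big_le : 6 / (I.big : ℝ) ≤ 6 / 13 :=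
  div_le_div_of_nonneg_left (by norm_num) (by norm_num) I.thirteen_le_big

theorem bound_lt : I.bound < 1 / (I.big : ℝ) ^ 3 := by
  have big_ge := I.thirteen_le_big
  calc I.bound = 1 / (I.big : ℝ) ^ 4 * ((I.sum : ℝ) ^ 2 / I.t + 6 / I.big) := I.bound_eq_mul
    _ < 1 / (I.big : ℝ) ^ 4 * I.big := by
        gcongr
        linarith [I.sum_sq_div_le, I.six_div_big_le]
    _ = 1 / (I.big : ℝ) ^ 3 := by field_simp

theorem lt_of_mul_le_bound {Q : ℝ}
    (hQ : (1 - ∑ i, I.prob i) * (1 / (I.big : ℝ) ^ 4 * Q) ≤ I.bound) :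
    Q < (I.sum : ℝ) ^ 2 / I.t + 1 := by
  have big_ge := I.thirteen_le_big
  by_contra! hlt
  have reduced : (1 - ∑ i, I.prob i) * Q ≤ (I.sum : ℝ) ^ 2 / I.t + 6 / I.big := by
    rw [bound_eq_mul, mul_left_comm] at hQ
    exact le_of_mul_le_mul_left hQ (by positivity)
  have mass_mul_le : (∑ i, I.prob i) * ((I.sum : ℝ) ^ 2 / I.t + 1) ≤ 1 / 13 :=
    calc (∑ i, I.prob i) * ((I.sum : ℝ) ^ 2 / I.t + 1)
        ≤ 1 / (I.big : ℝ) ^ 3 * I.big := by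
          gcongr
          · exact I.sum_prob_le
          · linarith [I.sum_sq_div_le]
      _ = 1 / (I.big : ℝ) ^ 2 := by field_simp
      _ ≤ 1 / 13 := one_div_le_one_div_of_le (by norm_num)
          (big_ge.trans (le_self_pow₀ (by linarith) two_ne_zero))
  have mono : (1 - ∑ i, I.prob i) * ((I.sum : ℝ) ^ 2 / I.t + 1) ≤ (1 - ∑ i, I.prob i) * Q :=
    mul_le_mul_of_nonneg_left hlt (by linarith [I.half_le_one_sub_sum_prob])
  linarith [I.six_div_big_le]

section Cover

variable {I} {B : Finset (Cube (I.m + 1))}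

theorem exists_mem_forall_ne_one (hE : expectedCost (bernoulliMeasure I.prob) I.cost B ≤
    ENNReal.ofReal I.bound) : ∃ b ∈ B, ∀ i, b i ≠ 1 := by
  by_contra! h
  have floorCost_ge (b : Cube (I.m + 1)) (hb : b ∈ B) : 1 ≤ floorCost I.cost b := by
    obtain ⟨i, hi⟩ := h b hb
    exact (I.one_le_cost i).trans (le_floorCost I.cost_nonneg hi)
  have lower_bound := (ENNReal.ofReal_le_ofReal_iff I.bound_nonneg).1
    ((one_sub_sum_mul_le_expectedCost I.prob_mem_Icc I.cost_nonneg zero_le_one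
      floorCost_ge).trans hE)
  linarith [I.half_le_one_sub_sum_prob, I.bound_lt, I.one_div_big_cube_le_half]

theorem exists_floorCost_lt (hE : expectedCost (bernoulliMeasure I.prob) I.cost B ≤
    ENNReal.ofReal I.bound) (i : Fin I.m) :
    ∃ b ∈ B, b i.castSucc = 1 ∧ floorCost I.cost b < 2 * I.big := by
  by_contra! h
  have big_ge := I.thirteen_le_big
  have lower_bound := (ENNReal.ofReal_le_ofReal_iff I.bound_nonneg).1
    ((one_sub_sum_mul_sum_le_expectedCost I.prob_mem_Icc I.cost_nonneg (J := {i.castSucc})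
      (r := fun _ => 2 * I.big) (fun _ _ => by positivity) (by simpa using h)).trans hE)
  rw [Finset.sum_singleton, prob_castSucc] at lower_bound
  refine absurd lower_bound (not_le.2 (I.bound_lt.trans_le ?_))
  calc 1 / (I.big : ℝ) ^ 3 = 1 / 2 * (1 / (I.big : ℝ) ^ 4 * (2 * I.big)) := by field_simp
    _ ≤ (1 - ∑ i, I.prob i) * (I.a i / (I.big : ℝ) ^ 4 * (2 * I.big)) := by
        gcongr
        · exact I.half_le_one_sub_sum_prob.trans' (by norm_num)
        · exact I.half_le_one_sub_sum_prob
        · exact I.one_le_a i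

theorem exists_assignment (one_mem : 1 ∈ B) (hcard : B.card = I.t + 2)
    (hE : expectedCost (bernoulliMeasure I.prob) I.cost B ≤ ENNReal.ofReal I.bound) :
    ∃ φ : Fin I.m → Fin I.t, ∀ i, ∀ b ∈ B, b i.castSucc = 1 →
      ∑ k with φ k = φ i, (I.a k : ℝ) ≤ floorCost I.cost b := by
  obtain ⟨b₀, b₀_mem, b₀_ne_one⟩ := exists_mem_forall_ne_one hE
  have exists_min (i : Fin I.m) : ∃ b ∈ B, b i.castSucc = 1 ∧
      ∀ b' ∈ B, b' i.castSucc = 1 → floorCost I.cost b ≤ floorCost I.cost b' := by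
    simpa [and_assoc] using Finset.exists_min_image (B.filter (· i.castSucc = 1))
      (floorCost I.cost) ⟨1, by simp [one_mem]⟩
  choose β β_mem β_one β_min using exists_min
  have β_ne_one (i : Fin I.m) : β i ≠ 1 := fun h => by
    obtain ⟨b, hb, hb1, hlt⟩ := exists_floorCost_lt hE i
    have last_le := le_floorCost I.cost_nonneg (b := β i) (i := Fin.last I.m) (by simp [h])
    rw [cost_last] at last_le
    exact absurd hlt (not_lt.2 (last_le.trans (β_min i b hb hb1)))
  have β_mem_erase (i : Fin I.m) : β i ∈ (B.erase 1).erase b₀ :=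
    Finset.mem_erase.2 ⟨fun h => b₀_ne_one i.castSucc (h ▸ β_one i),
      Finset.mem_erase.2 ⟨β_ne_one i, β_mem i⟩⟩
  have card_erase : ((B.erase 1).erase b₀).card = I.t := by
    have b₀_mem_erase : b₀ ∈ B.erase 1 :=
      Finset.mem_erase.2 ⟨fun h => b₀_ne_one 0 (h ▸ rfl), b₀_mem⟩
    rw [Finset.card_erase_of_mem b₀_mem_erase, Finset.card_erase_of_mem one_mem, hcard]
    rfl
  let e := Finset.equivFinOfCardEq card_erase
  refine ⟨fun i => e ⟨β i, β_mem_erase i⟩, fun i b hb hb1 => le_trans ?_ (β_min i b hb hb1)⟩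
  simp only [EmbeddingLike.apply_eq_iff_eq, Subtype.mk.injEq]
  have block_le := sum_le_floorCost I.cost_nonneg (b := β i)
    (T := (Finset.univ.filter (β · = β i)).map Fin.castSuccEmb) (by
      simp only [Finset.mem_map, Finset.mem_filter, Finset.mem_univ, true_and]
      rintro _ ⟨k, hk, rfl⟩
      exact hk ▸ β_one k)
  simpa [cost_castSucc] using block_le

theorem sum_sq_block_lt {φ : Fin I.m → Fin I.t}
    (hE : expectedCost (bernoulliMeasure I.prob) I.cost B ≤ ENNReal.ofReal I.bound)
    (hφ : ∀ i, ∀ b ∈ B, b i.castSucc = 1 →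
      ∑ k with φ k = φ i, (I.a k : ℝ) ≤ floorCost I.cost b) :
    ∑ j, (∑ i with φ i = j, (I.a i : ℝ)) ^ 2 < (I.sum : ℝ) ^ 2 / I.t + 1 := by
  let r : Fin (I.m + 1) → ℝ :=
    Fin.snoc (α := fun _ => ℝ) (fun i => ∑ k with φ k = φ i, (I.a k : ℝ)) 0
  have r_castSucc (i : Fin I.m) : r i.castSucc = ∑ k with φ k = φ i, (I.a k : ℝ) :=
    Fin.snoc_castSucc ..
  have lower_bound := (ENNReal.ofReal_le_ofReal_iff I.bound_nonneg).1
    ((one_sub_sum_mul_sum_le_expectedCost I.prob_mem_Icc I.cost_nonneg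
      (J := Finset.univ.map Fin.castSuccEmb) (r := r)
      (by simpa [r_castSucc] using fun i => Finset.sum_nonneg fun _ _ => Nat.cast_nonneg _)
      (by simpa [r_castSucc] using hφ)).trans hE)
  refine I.lt_of_mul_le_bound (le_of_eq_of_le ?_ lower_bound)
  rw [← sum_mul_sum_fiber, Finset.sum_map, Finset.mul_sum]
  simp only [Fin.coe_castSuccEmb, prob_castSucc, r_castSucc]
  congr 1
  exact Finset.sum_congr rfl fun i _ => by ring

theorem isYes_of_toPareto (h : I.toPareto.IsYes) : I.IsYes := by
  obtain ⟨B, one_mem, hcard, hE⟩ := I.isYes_toPareto_iff.1 h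
  obtain ⟨φ, hφ⟩ := exists_assignment one_mem hcard hE
  obtain ⟨q, sum_eq : I.sum = I.t * q⟩ := I.dvd_sum
  have t_ne_zero : (I.t : ℝ) ≠ 0 := Nat.cast_ne_zero.2 I.t_pos.ne'
  have sum_blocks : ∑ j, ∑ i with φ i = j, I.a i = I.t * q :=
    (Finset.sum_fiberwise _ φ I.a).trans sum_eq
  have sum_sq_le : ∑ j, (∑ i with φ i = j, I.a i) ^ 2 ≤ I.t * q ^ 2 := by
    have square_mean : (I.sum : ℝ) ^ 2 / I.t = I.t * (q : ℝ) ^ 2 := by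
      rw [sum_eq]
      push_cast
      field_simp
    have sum_sq_lt := square_mean ▸ sum_sq_block_lt hE hφ
    exact Nat.lt_succ_iff.1 (by exact_mod_cast sum_sq_lt)
  have block_eq (j : Fin I.t) : ∑ i with φ i = j, (I.a i : ℤ) = q :=
    eq_of_sum_sq_le (s := fun j => ∑ i with φ i = j, (I.a i : ℤ))
      (by rw [Fintype.card_fin]; exact_mod_cast sum_blocks)
      (by rw [Fintype.card_fin]; exact_mod_cast sum_sq_le) j
  refine I.isYes_iff_exists_assignment.2 ⟨φ, fun j => ?_⟩
  rw [sum_eq]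
  congr 1
  exact_mod_cast block_eq j

end Cover

end NumberPartitioningInstance

end ParetoCover

theorem mainTheorem7 :
    ∃ f : ParetoCover.NumberPartitioningInstance → ParetoCover.BinaryParetoInstance,
      ParetoCover.IsPolyTimeReduction
        ParetoCover.numberPartitioning ParetoCover.binaryParetoCover f ∧
      ∀ I : ParetoCover.NumberPartitioningInstance,
        (f I).k = I.t + 2 ∧
        ∃ hn : (f I).n = I.m + 1,
          let S : ℚ := ∑ i, (I.a i : ℚ)
          let M : ℚ := 13 * S ^ 2
          (∀ i : Fin I.m,
            ((f I).p (Fin.cast hn.symm i.castSucc)).val = (I.a i : ℚ) / M ^ 4 ∧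
            ((f I).c (Fin.cast hn.symm i.castSucc)).val = (I.a i : ℚ)) ∧
          ((f I).p (Fin.cast hn.symm (Fin.last I.m))).val = 1 / M ^ 6 ∧
          ((f I).c (Fin.cast hn.symm (Fin.last I.m))).val = 2 * M ∧
          (f I).γ.val = 1 / M ^ 4 * (S ^ 2 / (I.t : ℚ)) + 6 / M ^ 5 := by
  refine ⟨ParetoCover.NumberPartitioningInstance.toPareto,
    ⟨ParetoCover.Reduction.toPareto_computable,
      fun I => ⟨I.isYes_toPareto, ParetoCover.NumberPartitioningInstance.isYes_of_toPareto⟩⟩,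
    fun I => ⟨rfl, rfl, ?_⟩⟩
  intro S M
  have S_eq : S = I.sum := (Nat.cast_sum _ _).symm
  have M_eq : M = I.big := by simp [M, S_eq, ParetoCover.NumberPartitioningInstance.big]
  rw [M_eq, S_eq]
  exact ⟨fun i => ⟨I.toPareto_p_castSucc i, I.toPareto_c_castSucc i⟩, I.toPareto_p_last,
    I.toPareto_c_last, I.toPareto_gamma⟩
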